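/- Let $A\in\mathbb R^{n\times n}$, $B\in\mathbb R^{n\times q}$, $C\in\mathbb R^{q\times n}$ be such that the nominal closed loop $\dot x=(A+BC)x$ is exponentially stable, and put $F_{11}=A+BC$, $F_{12}=B$, $F_{21}=-C(A+BC)$, $F_{22}=-CB$. Let $|\cdot|$ denote the Euclidean norm of vectors and the induced norm of matrices. Policy. (A1) Let $\gamma_x>0$, $0<\epsilon\le\frac1q$, $Q=Q^T>0$, $P_1=P_1^T>0$ and $P_2=\mathrm{diag}(p_1,\dots,p_q)>0$ satisfy $F_{11}^TP_1+P_1F_{11}\le -Q$ and $\frac{\gamma_x}{\epsilon}I<Q$. (A2) Let $a=2|P_1F_{12}|$, $b=2|F_{21}|$, $c=2|F_{22}|$, let $\alpha_1,\dots,\alpha_q$ satisfy $\alpha_i>\epsilon$ and $\sum_{i=1}^q\alpha_i=1$, and for each $i$ let $\overline{\mathcal C}_i$ and $\overline{\mathcal D}_i$ be the sets of $(x,e_i)\in\mathbb R^n\times\mathbb R$ with, respectively, $$-\alpha_i x^TQx+(a+bp_i)|x||e_i|+cp_ie_i^2\le-\gamma_x|x|^2,\qquad -\alpha_i x^TQx+(a+bp_i)|x||e_i|+cp_ie_i^2\ge-\gamma_x|x|^2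 .$$ Closed loop. For $0<\Delta<\rho$ consider the hybrid system with state $(x,e,\tau)\in\mathbb R^n\times\mathbb R^q\times[0,\infty)^q$ (sensor $i$ has error $e_i$ and timer $\tau_i$) which flows according to $$\dot x=F_{11}x+F_{12}e,\qquad \dot e=F_{21}x+F_{22}e,\qquad \dot\tau_i=1-f(\tau_i/\rho),\qquad f(s)=\begin{cases}0,&|s|\le1\\ \mathrm{sgn}(s)(|s|-1),&|s|>1\end{cases}$$ on the set where, for every $i$, $(x,e_i)\in\overline{\mathcal C}_i$ or $\tau_i\le\Delta$, and which may jump if for some $i$ sensor $i$ is enabled, i.e. $(x,e_i)\in\overline{\mathcal D}_i$ and $\tau_i\ge\Delta$. A jump keeps $x$ and sets $e_i^+=0$, $\tau_i^+=0$ for the transmitting sensors, all other $e_j,\tau_j$ being unchanged. The transmitting sensors are either one arbitrary enabled sensor per jump (simultaneous transmissions being consecutive jumps) or all enabled sensors at once; the result holds under either convention. Theorem. Assume in addition that $CB\neq0$ or that $B$ has full column rank. Then there is $\rho_0>0$ such that for all $0<\Delta<\rho<\rho_0$ the compact set $\mathcal A=\{0\}\times\{0\}\times[0,2\rho]^q$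 is globally asymptotically stable for this system: it is stable, every maximal solution is complete, and every solution is bounded and, if complete, converges to $\mathcal A$. If moreover $B$ has full column rank, then $\mathcal A$ is globally exponentially stable: there are $k,\gamma>0$ such that every solution $X$ satisfies $|X(t,j)|_{\mathcal A}\le k\,e^{-\gamma(t+j)}|X(0,0)|_{\mathcal A}$ for all $(t,j)$ in its domain, where $|\cdot|_{\mathcal A}$ is the Euclidean distance to $\mathcal A$, $t$ is the time and $j$ the number of jumps. -/

import Mathlib

open Set Filter Topology MeasureTheory
open scoped Matrix

noncomputable section

/-! ## Hybrid systems, their solutions, and stability of sets -/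

namespace Hybrid

/-- A hybrid system `(C, D, F, G)` with set-valued flow map `F` and jump map `G`. -/
structure System (E : Type*) where
  flowSet : Set E
  jumpSet : Set E
  flowMap : E → Set E
  jumpMap : E → Set E

/-- Hybrid time domains: the union of infinitely many intervals `[t_j, t_{j+1}] × {j}` with
`0 = t_0 ≤ t_1 ≤ ...`, or of finitely many of them, the last one (of index `J`) being nonempty and
of the form `[t_J, t_{J+1}]`, `[t_J, t_{J+1})` or `[t_J, ∞)`. -/
def IsTimeDomain (T : Set (ℝ × ℕ)) : Prop :=
  ∃ t : ℕ → ℝ, t 0 = 0 ∧ Monotone t ∧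
    (T = {p | p.1 ∈ Icc (t p.2) (t (p.2 + 1))} ∨
      ∃ (J : ℕ) (L : Set ℝ), L.Nonempty ∧
        (L = Icc (t J) (t (J + 1)) ∨ L = Ico (t J) (t (J + 1)) ∨ L = Ici (t J)) ∧
        T = {p | (p.2 < J ∧ p.1 ∈ Icc (t p.2) (t (p.2 + 1))) ∨ (p.2 = J ∧ p.1 ∈ L)})

/-- The interval `I_j = {t | (t, j) ∈ T}`. -/
def slice (T : Set (ℝ × ℕ)) (j : ℕ) : Set ℝ := {t | (t, j) ∈ T}

variable {E : Type*} [NormedAddCommGroup E] [NormedSpace ℝ E]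

/-- A hybrid arc with domain `T`; the values of `φ` outside `T` are irrelevant. -/
structure IsArc (T : Set (ℝ × ℕ)) (φ : ℝ → ℕ → E) : Prop where
  timeDomain : IsTimeDomain T
  locallyAC : ∀ j, ∀ a ∈ slice T j, ∀ b ∈ slice T j, a ≤ b →
    AbsolutelyContinuousOnInterval (fun t => φ t j) a b

/-- The hybrid arc `φ` with domain `T` is a solution of `H` (started in the set `C ∪ D`). -/
structure IsSolution (H : System E) (T : Set (ℝ × ℕ)) (φ : ℝ → ℕ → E) : Prop where
  arc : IsArc T φ
  start : φ 0 0 ∈ H.flowSet ∪ H.jumpSet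
  flow_deriv : ∀ j, (interior (slice T j)).Nonempty →
    ∀ᵐ t ∂(volume.restrict (slice T j)),
      ∃ v ∈ H.flowMap (φ t j), HasDerivAt (fun s => φ s j) v t
  flow_mem : ∀ j, ∀ t ∈ slice T j, (∃ s ∈ slice T j, t < s) → φ t j ∈ H.flowSet
  jump : ∀ t j, (t, j) ∈ T → (t, j + 1) ∈ T →
    φ t j ∈ H.jumpSet ∧ φ t (j + 1) ∈ H.jumpMap (φ t j)

/-- No solution extends `φ` to a strictly larger domain. -/
def IsMaximal (H : System E) (T : Set (ℝ × ℕ)) (φ : ℝ → ℕ → E) : Prop :=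
  ¬ ∃ (T' : Set (ℝ × ℕ)) (φ' : ℝ → ℕ → E), IsSolution H T' φ' ∧ T ⊂ T' ∧
    ∀ t j, (t, j) ∈ T → φ' t j = φ t j

/-- A solution with domain `T` is complete if `T` is unbounded. -/
def IsComplete (T : Set (ℝ × ℕ)) : Prop := ¬ Bornology.IsBounded T

def IsBoundedArc (T : Set (ℝ × ℕ)) (φ : ℝ → ℕ → E) : Prop :=
  ∃ M : ℝ, ∀ t j, (t, j) ∈ T → ‖φ t j‖ ≤ M

/-- `|φ(t, j)|_A → 0` as `t + j → ∞` in the domain `T`. -/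
def ConvergesTo (T : Set (ℝ × ℕ)) (φ : ℝ → ℕ → E) (A : Set E) : Prop :=
  ∀ r > 0, ∃ S : ℝ, ∀ t j, (t, j) ∈ T → S ≤ t + (j : ℝ) → Metric.infDist (φ t j) A ≤ r

def IsStable (H : System E) (A : Set E) : Prop :=
  ∀ r > 0, ∃ δ > 0, ∀ (T : Set (ℝ × ℕ)) (φ : ℝ → ℕ → E), IsSolution H T φ →
    Metric.infDist (φ 0 0) A ≤ δ → ∀ t j, (t, j) ∈ T → Metric.infDist (φ t j) A ≤ r

def IsAttractive (H : System E) (A : Set E) : Prop :=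
  (∀ (T : Set (ℝ × ℕ)) (φ : ℝ → ℕ → E), IsSolution H T φ → IsMaximal H T φ → IsComplete T) ∧
  ∃ δ > 0, ∀ (T : Set (ℝ × ℕ)) (φ : ℝ → ℕ → E), IsSolution H T φ →
    Metric.infDist (φ 0 0) A ≤ δ → IsBoundedArc T φ ∧ (IsComplete T → ConvergesTo T φ A)

def IsAsymptoticallyStable (H : System E) (A : Set E) : Prop :=
  IsStable H A ∧ IsAttractive H A

def IsExponentiallyStable (H : System E) (A : Set E) : Prop :=
  ∃ γ > 0, ∃ k > 0, ∀ (T : Set (ℝ × ℕ)) (φ : ℝ → ℕ → E), IsSolution H T φ →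
    ∀ t j, (t, j) ∈ T →
      Metric.infDist (φ t j) A ≤ k * Real.exp (-γ * (t + (j : ℝ))) * Metric.infDist (φ 0 0) A

/-- The points from which every solution is bounded and every complete one converges to `A`. -/
def basin (H : System E) (A : Set E) : Set E :=
  {ξ | ∀ (T : Set (ℝ × ℕ)) (φ : ℝ → ℕ → E), IsSolution H T φ → φ 0 0 = ξ →
    IsBoundedArc T φ ∧ (IsComplete T → ConvergesTo T φ A)}

def IsGAS (H : System E) (A : Set E) : Prop :=
  IsAsymptoticallyStable H A ∧ basin H A = univ

def IsGES (H : System E) (A : Set E) : Prop :=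
  IsExponentiallyStable H A ∧ basin H A = univ

end Hybrid

/-! ## The transmission-lazy closed loop -/

namespace TLazy

/-- `M` acting on Euclidean vectors. -/
abbrev act {m k : ℕ} (M : Matrix (Fin m) (Fin k) ℝ) (v : EuclideanSpace ℝ (Fin k)) :
    EuclideanSpace ℝ (Fin m) :=
  WithLp.toLp 2 (M *ᵥ v.ofLp)

open scoped Matrix.Norms.L2Operator in
/-- The matrix norm induced by the Euclidean norms. -/
def opNorm {m k : ℕ} (M : Matrix (Fin m) (Fin k) ℝ) : ℝ := ‖M‖

/-- Exponential stability of `ẋ = M x`, through its trajectories. -/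
def LinearExpStable {n : ℕ} (M : Matrix (Fin n) (Fin n) ℝ) : Prop :=
  ∃ k > 0, ∃ γ > 0, ∀ x : ℝ → EuclideanSpace ℝ (Fin n),
    (∀ t, 0 ≤ t → HasDerivWithinAt x (act M (x t)) (Ici 0) t) →
    ∀ t, 0 ≤ t → ‖x t‖ ≤ k * Real.exp (-γ * t) * ‖x 0‖

/-- The scalar deadzone with unit threshold. -/
def dz (s : ℝ) : ℝ := if |s| ≤ 1 then 0 else Real.sign s * (|s| - 1)

/-- The plant-controller cascade `ẋ = A x + B u`, `y = C x`, and the parameters of the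
asynchronous policy; `P₂ = diag(p₁, ..., p_q)`. -/
structure Data (n q : ℕ) where
  A : Matrix (Fin n) (Fin n) ℝ
  B : Matrix (Fin n) (Fin q) ℝ
  C : Matrix (Fin q) (Fin n) ℝ
  γx : ℝ
  ε : ℝ
  Q : Matrix (Fin n) (Fin n) ℝ
  P₁ : Matrix (Fin n) (Fin n) ℝ
  p : Fin q → ℝ
  α : Fin q → ℝ

namespace Data

variable {n q : ℕ} (S : Data n q)

def F₁₁ : Matrix (Fin n) (Fin n) ℝ := S.A + S.B * S.C
def F₁₂ : Matrix (Fin n) (Fin q) ℝ := S.B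
def F₂₁ : Matrix (Fin q) (Fin n) ℝ := -(S.C * (S.A + S.B * S.C))
def F₂₂ : Matrix (Fin q) (Fin q) ℝ := -(S.C * S.B)

/-- The conditions on the parameters of the policy; matrix inequalities are in the sense of
symmetric (semi)definite matrices. -/
structure Admissible : Prop where
  γx_pos : 0 < S.γx
  ε_pos : 0 < S.ε
  ε_le : S.ε ≤ 1 / (q : ℝ)
  Q_pos : S.Q.PosDef
  P₁_pos : S.P₁.PosDef
  p_pos : ∀ i, 0 < S.p i
  lyapunov : (-S.Q - (S.F₁₁ᵀ * S.P₁ + S.P₁ * S.F₁₁)).PosSemidef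
  Q_large : (S.Q - (S.γx / S.ε) • (1 : Matrix (Fin n) (Fin n) ℝ)).PosDef

/-- The weights of the sensors. -/
structure AdmissibleWeights : Prop where
  sum_eq_one : ∑ i, S.α i = 1
  gt_ε : ∀ i, S.ε < S.α i

def a : ℝ := 2 * opNorm (S.P₁ * S.F₁₂)
def b : ℝ := 2 * opNorm S.F₂₁
def c : ℝ := 2 * opNorm S.F₂₂

/-- `-αᵢ xᵀQx + (a + b pᵢ)|x||eᵢ| + c pᵢ eᵢ²`. -/
def trigger (i : Fin q) (x : EuclideanSpace ℝ (Fin n)) (s : ℝ) : ℝ :=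
  -S.α i * (x.ofLp ⬝ᵥ S.Q *ᵥ x.ofLp) + (S.a + S.b * S.p i) * ‖x‖ * |s| + S.c * S.p i * s ^ 2

/-- The set `C̄ᵢ` of pairs `(x, eᵢ)`. -/
def Cbar (i : Fin q) : Set (EuclideanSpace ℝ (Fin n) × ℝ) :=
  {z | S.trigger i z.1 z.2 ≤ -S.γx * ‖z.1‖ ^ 2}

/-- The set `D̄ᵢ` of pairs `(x, eᵢ)`. -/
def Dbar (i : Fin q) : Set (EuclideanSpace ℝ (Fin n) × ℝ) :=
  {z | -S.γx * ‖z.1‖ ^ 2 ≤ S.trigger i z.1 z.2}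

end Data

/-- The state space `ℝⁿ × ℝ^q × ℝ^q` of the states `(x, e, τ)`, with its Euclidean norm. -/
abbrev State (n q : ℕ) : Type := EuclideanSpace ℝ (Fin n ⊕ Fin q ⊕ Fin q)

namespace State

variable {n q : ℕ}

def x (X : State n q) : EuclideanSpace ℝ (Fin n) := WithLp.toLp 2 fun i => X (Sum.inl i)
def e (X : State n q) : EuclideanSpace ℝ (Fin q) :=
  WithLp.toLp 2 fun i => X (Sum.inr (Sum.inl i))
def τ (X : State n q) : EuclideanSpace ℝ (Fin q) :=
  WithLp.toLp 2 fun i => X (Sum.inr (Sum.inr i))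

/-- The state with components `x`, `e`, `τ`. -/
def mk (x : EuclideanSpace ℝ (Fin n)) (e τ : EuclideanSpace ℝ (Fin q)) : State n q :=
  WithLp.toLp 2 (Sum.elim x (Sum.elim e τ))

end State

variable {n q : ℕ}

/-- Sensor `i` may transmit: `(x, eᵢ) ∈ D̄ᵢ` and `τᵢ ≥ Δ`. -/
def Enabled (S : Data n q) (Δ : ℝ) (X : State n q) (i : Fin q) : Prop :=
  (State.x X, State.e X i) ∈ S.Dbar i ∧ Δ ≤ State.τ X i

/-- The flow set; the timers live in `[0, ∞)`. -/
def flowSet (S : Data n q) (Δ : ℝ) : Set (State n q) :=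
  {X | ∀ i, 0 ≤ State.τ X i ∧
    ((State.x X, State.e X i) ∈ S.Cbar i ∨ State.τ X i ≤ Δ)}

/-- The jump set; the timers live in `[0, ∞)`. -/
def jumpSet (S : Data n q) (Δ : ℝ) : Set (State n q) :=
  {X | (∀ i, 0 ≤ State.τ X i) ∧ ∃ i, Enabled S Δ X i}

def flowMap (S : Data n q) (ρ : ℝ) (X : State n q) : State n q :=
  State.mk (act S.F₁₁ (State.x X) + act S.F₁₂ (State.e X))
    (act S.F₂₁ (State.x X) + act S.F₂₂ (State.e X))
    (WithLp.toLp 2 fun i => 1 - dz (State.τ X i / ρ))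

open Classical in
/-- The sensors in `I` transmit: `eᵢ⁺ = 0` and `τᵢ⁺ = 0` for `i ∈ I`, and nothing else changes.
In terms of the held samples `ν = e + C x` this is `νᵢ⁺ = (C x)ᵢ` for `i ∈ I`. -/
def transmit (I : Set (Fin q)) (X : State n q) : State n q :=
  State.mk (State.x X)
    (WithLp.toLp 2 fun i => if i ∈ I then 0 else State.e X i)
    (WithLp.toLp 2 fun i => if i ∈ I then 0 else State.τ X i)

/-- The two conventions for states in which several sensors are enabled at once. -/
inductive JumpRule
  /-- One jump lets exactly one enabled sensor transmit (set-valued, outer semicontinuous);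
  simultaneous transmissions are several consecutive jumps. -/
  | sequential
  /-- One jump lets all the enabled sensors transmit (single-valued). -/
  | simultaneous

def jumpMap (S : Data n q) (Δ : ℝ) : JumpRule → State n q → Set (State n q)
  | .sequential, X => {Y | ∃ i, Enabled S Δ X i ∧ Y = transmit {i} X}
  | .simultaneous, X => {transmit {i | Enabled S Δ X i} X}

/-- The closed loop under the asynchronous policy, in the coordinates `(x, e, τ)`. -/
def closedLoop (S : Data n q) (Δ ρ : ℝ) (R : JumpRule) : Hybrid.System (State n q) where
  flowSet := flowSet S Δ
  jumpSet := jumpSet S Δ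
  flowMap := fun X => {flowMap S ρ X}
  jumpMap := jumpMap S Δ R

/-- `{0} × {0} × [0, 2ρ]^q`. -/
def attractor (n q : ℕ) (ρ : ℝ) : Set (State n q) :=
  {X | State.x X = 0 ∧ State.e X = 0 ∧ ∀ i, State.τ X i ∈ Icc 0 (2 * ρ)}

end TLazy

end

/-! Everything rests on one Lyapunov function, `lyap`: the quadratic form of P₁ in x, plus the
errors eᵢ² weighted by μ exp(-M θ(τᵢ)), plus the squared excess of the timers over 2ρ. The phase θ
is `timerPhase`: it has slope one during the dwell time τᵢ ≤ Δ, flattens out by ρ, and takes values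
in [0, ρ]. A jump only deletes error terms and timer excesses, so the function never grows there
(`lyap_transmit_le`).

Along flows, xᵀQx is split into the shares αᵢ xᵀQx. A sensor with τᵢ > Δ lies in C̄ᵢ, where its
share dominates a|x||eᵢ| and leaves γₓ|x|². A sensor with τᵢ ≤ Δ has a share worth γₓ|x|² by itself,
but its cross term remains. The plant part therefore has derivative at most -qγₓ|x|² plus a|x| times
the sum of |eᵢ| over the dwelling sensors. Those errors are paid for by the decreasing weights,
which contribute -M times the weighted eᵢ². The other errors obey |eᵢ| ≤ κ|x|, so a small μ makes
their growth negligible. `exists_decay_constants` chooses μ first and M afterwards; ρ < 1/M keeps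
all weights within a factor three of each other. The outcome is `exists_lyapDeriv_le`.

The bound |eᵢ| ≤ κ|x| comes from C̄ᵢ when x ≠ 0. At x = 0 it needs nondegeneracy: either CB ≠ 0
forces eᵢ = 0, or B is injective and a nonzero error moves x off zero at once, so the bound passes
to the limit (`abs_le_gain_mul_of_flow`).

The dwell time bounds the number of jumps linearly in t (`jumps_mul_le`), turning decay in t into
decay in t + j (`exists_isExponentiallyStable`). Boundedness and viability then exclude maximal
solutions with bounded domain (`isComplete_of_isMaximal`). -/

noncomputable section

namespace Hybrid

/-! ### Classical regularity of absolutely continuous solutions. -/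

section Regularity

variable {E : Type*} [NormedAddCommGroup E] [NormedSpace ℝ E] [CompleteSpace E]

/-- An absolutely continuous function whose a.e. derivative is continuous is differentiable in the
interior. -/
theorem hasDerivAt_of_ae_of_continuousOn {f v : ℝ → E} {a b : ℝ} (hab : a ≤ b)
    (hf : AbsolutelyContinuousOnInterval f a b) (hv : ContinuousOn v (Icc a b))
    (h : ∀ᵐ t, t ∈ Icc a b → HasDerivAt f (v t) t) {t : ℝ} (ht : t ∈ Ioo a b) :
    HasDerivAt f (v t) t := by
  set u : ℝ → E := IccExtend hab ((Icc a b).domRestrict v)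
  have hu : Continuous u := (continuousOn_iff_continuous_domRestrict.1 hv).Icc_extend'
  have huv : ∀ s ∈ Icc a b, u s = v s := fun s hs => by
    rw [show u s = _ from IccExtend_of_mem hab _ hs]; rfl
  set G : ℝ → E := fun s => ∫ r in a..s, u r
  have hG : ∀ s, HasDerivAt G (u s) s := fun s => hu.integral_hasStrictDerivAt a s |>.hasDerivAt
  have hG1 : ContDiff ℝ 1 G := by
    rw [contDiff_one_iff_deriv]
    exact ⟨fun s => (hG s).differentiableAt, by rwa [funext fun s => (hG s).deriv]⟩
  -- `G` is a primitive of the clamped extension of `v`, so `f - G` is absolutely continuous with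
  -- derivative zero almost everywhere, hence constant.
  have hsub : AbsolutelyContinuousOnInterval (f - G) a b :=
    hf.sub hG1.contDiffOn.absolutelyContinuousOnInterval
  obtain ⟨c, hc⟩ := hsub.const_of_ae_hasDerivAt_zero (by
    filter_upwards [h] with s hs hs'
    rw [uIcc_of_le hab] at hs'
    have := (hs hs').sub (hG s)
    rwa [huv s hs', sub_self] at this)
  rw [uIcc_of_le hab] at hc
  have heq : f =ᶠ[𝓝 t] fun s => G s + c := by
    filter_upwards [Icc_mem_nhds ht.1 ht.2] with s hs
    rw [← hc s hs]; simp
  rw [heq.hasDerivAt_iff, ← huv t (Ioo_subset_Icc_self ht)]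
  exact (hG t).add_const c

end Regularity

/-! ### Structure of hybrid time domains and induction along them. -/

section TimeDomain

variable {T : Set (ℝ × ℕ)}

/-- The intervals of a hybrid time domain, as a sequence of their left end points. -/
theorem IsTimeDomain.exists_seq (hT : IsTimeDomain T) :
    ∃ t : ℕ → ℝ, t 0 = 0 ∧ Monotone t ∧ (∀ s j, (s, j) ∈ T → t j ≤ s ∧ (t j, j) ∈ T) ∧
      (∀ s j, (s, j + 1) ∈ T → (t (j + 1), j) ∈ T) ∧
      (∀ j, (slice T j).OrdConnected) ∧ (0, 0) ∈ T := by
  obtain ⟨t, h0, hm, h⟩ := hT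
  refine ⟨t, h0, hm, ?_⟩
  rcases h with rfl | ⟨J, L, hL, hL', rfl⟩
  · refine ⟨fun s j h => ⟨h.1, le_rfl, h.1.trans h.2⟩, fun s j _ => ⟨hm j.le_succ, le_rfl⟩,
      fun j => (ordConnected_Icc : (Icc (t j) (t (j + 1))).OrdConnected), ?_⟩
    exact ⟨h0.le, h0 ▸ hm (Nat.zero_le 1)⟩
  · have hle : ∀ s ∈ L, t J ≤ s := by
      rcases hL' with rfl | rfl | rfl
      · exact fun s h => h.1
      · exact fun s h => h.1
      · exact fun s h => h
    have hmem : t J ∈ L := by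
      obtain ⟨s, hs⟩ := hL
      rcases hL' with rfl | rfl | rfl
      · exact ⟨le_rfl, hs.1.trans hs.2⟩
      · exact ⟨le_rfl, hs.1.trans_lt hs.2⟩
      · exact self_mem_Ici
    have hoc : L.OrdConnected := by
      rcases hL' with rfl | rfl | rfl
      · exact ordConnected_Icc
      · exact ordConnected_Ico
      · exact ordConnected_Ici
    refine ⟨?_, ?_, ?_, ?_⟩
    · rintro s j (⟨hj, hs⟩ | ⟨rfl, hs⟩)
      · exact ⟨hs.1, Or.inl ⟨hj, le_rfl, hs.1.trans hs.2⟩⟩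
      · exact ⟨hle s hs, Or.inr ⟨rfl, hmem⟩⟩
    · rintro s j (⟨hj, hs⟩ | ⟨hj, hs⟩)
      · exact Or.inl ⟨(Nat.lt_succ_self j).trans hj, hm j.le_succ, le_rfl⟩
      · exact Or.inl ⟨by simp only at hj ⊢; omega, hm j.le_succ, le_rfl⟩
    · intro j
      rcases lt_trichotomy j J with hj | rfl | hj
      · convert (ordConnected_Icc : (Icc (t j) (t (j + 1))).OrdConnected) using 1
        ext s
        simp [slice, hj, hj.ne]
      · convert hoc using 1
        ext s
        simp [slice]
      · convert (ordConnected_empty : (∅ : Set ℝ).OrdConnected) using 1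
        ext s
        simp [slice, hj.ne', hj.not_gt]
    · rcases Nat.eq_zero_or_pos J with rfl | hJ
      · exact Or.inr ⟨rfl, h0 ▸ hmem⟩
      · exact Or.inl ⟨hJ, h0.le, h0 ▸ hm (Nat.zero_le 1)⟩

theorem IsTimeDomain.zero_mem (hT : IsTimeDomain T) : (0, 0) ∈ T := by
  obtain ⟨t, h⟩ := hT.exists_seq
  exact h.2.2.2.2.2

theorem IsTimeDomain.ordConnected (hT : IsTimeDomain T) (j : ℕ) : (slice T j).OrdConnected := by
  obtain ⟨t, h⟩ := hT.exists_seq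
  exact h.2.2.2.2.1 j

theorem IsTimeDomain.nonneg (hT : IsTimeDomain T) {s : ℝ} {j : ℕ} (h : (s, j) ∈ T) : 0 ≤ s := by
  obtain ⟨t, h0, hm, h1, -⟩ := hT.exists_seq
  exact h0 ▸ (hm (Nat.zero_le j)).trans (h1 s j h).1

/-- Induction along a hybrid time domain. -/
theorem IsTimeDomain.induction (hT : IsTimeDomain T) {P : ℝ → ℕ → Prop} (h0 : P 0 0)
    (hflow : ∀ j, ∀ s ∈ slice T j, ∀ t ∈ slice T j, s < t → P s j → P t j)
    (hjump : ∀ t j, (t, j) ∈ T → (t, j + 1) ∈ T → P t j → P t (j + 1)) :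
    ∀ t j, (t, j) ∈ T → P t j := by
  obtain ⟨t, ht0, hm, h1, h2, -, -⟩ := hT.exists_seq
  have hle : ∀ j, ∀ s ∈ slice T j, ∀ t ∈ slice T j, s ≤ t → P s j → P t j := by
    intro j s hs t ht hst hP
    rcases hst.eq_or_lt with rfl | hlt
    · exact hP
    · exact hflow j s hs t ht hlt hP
  intro s j
  induction j generalizing s with
  | zero =>
    intro hs
    exact hle 0 0 hT.zero_mem s hs (hT.nonneg hs) h0
  | succ j ih =>
    intro hs
    obtain ⟨hts, htm⟩ := h1 s _ hs
    exact hle _ _ htm s hs hts (hjump _ _ (h2 s j hs) htm (ih _ (h2 s j hs)))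

/-- A bounded time domain has finitely many intervals and a finite horizon. -/
theorem IsTimeDomain.exists_of_isBounded (hT : IsTimeDomain T) (hb : Bornology.IsBounded T) :
    ∃ (t : ℕ → ℝ) (J : ℕ) (L : Set ℝ), t 0 = 0 ∧ Monotone t ∧ t J ∈ L ∧
      (L = Icc (t J) (t (J + 1)) ∨ L = Ico (t J) (t (J + 1))) ∧
      T = {p | (p.2 < J ∧ p.1 ∈ Icc (t p.2) (t (p.2 + 1))) ∨ (p.2 = J ∧ p.1 ∈ L)} := by
  obtain ⟨t, h0, hm, h⟩ := hT
  rcases h with rfl | ⟨J, L, hL, hL', rfl⟩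
  · exfalso
    obtain ⟨R, hR⟩ := hb.image_snd.subset_closedBall 0
    obtain ⟨k, hk⟩ := exists_nat_gt R
    have := hR (mem_image_of_mem Prod.snd
      (show (t k, k) ∈ {p : ℝ × ℕ | p.1 ∈ Icc (t p.2) (t (p.2 + 1))} from ⟨le_rfl, hm k.le_succ⟩))
    rw [Metric.mem_closedBall, Nat.dist_eq] at this
    have := (le_abs_self _).trans this
    simp only [Nat.cast_zero, sub_zero] at this
    linarith
  · obtain ⟨s, hs⟩ := hL
    rcases hL' with rfl | rfl | rfl
    · exact ⟨t, J, _, h0, hm, left_mem_Icc.2 (hs.1.trans hs.2), Or.inl rfl, rfl⟩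
    · exact ⟨t, J, _, h0, hm, left_mem_Ico.2 (hs.1.trans_lt hs.2), Or.inr rfl, rfl⟩
    · exfalso
      obtain ⟨R, hR⟩ := hb.image_fst.subset_closedBall 0
      have := hR (mem_image_of_mem Prod.fst (show (max (t J) (R + 1), J) ∈ {p : ℝ × ℕ |
        (p.2 < J ∧ p.1 ∈ Icc (t p.2) (t (p.2 + 1))) ∨ (p.2 = J ∧ p.1 ∈ Ici (t J))} from
        Or.inr ⟨rfl, mem_Ici.2 (le_max_left _ _)⟩))
      rw [Metric.mem_closedBall, Real.dist_eq, sub_zero] at this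
      have h3 := (le_abs_self _).trans this
      have h4 := (le_max_right (t J) (R + 1)).trans h3
      linarith

end TimeDomain

/-! ### Solutions between jumps, and consequences of exponential stability. -/

section Solutions

variable {E : Type*} [NormedAddCommGroup E] [NormedSpace ℝ E]
variable {H : System E} {T : Set (ℝ × ℕ)} {φ : ℝ → ℕ → E}

/-- Under a continuous single-valued flow map, solutions are classical solutions of the
differential equation between jumps. -/
theorem IsSolution.flow_segment [CompleteSpace E] {F : E → E} (hF : Continuous F)
    (hH : ∀ X, H.flowMap X = {F X}) (h : IsSolution H T φ) {j : ℕ} {s t : ℝ}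
    (hs : s ∈ slice T j) (ht : t ∈ slice T j) (hst : s < t) :
    ContinuousOn (fun r => φ r j) (Icc s t) ∧
      (∀ r ∈ Ioo s t, HasDerivAt (fun r => φ r j) (F (φ r j)) r) ∧
      ∀ r ∈ Ico s t, φ r j ∈ H.flowSet := by
  have hsub : Icc s t ⊆ slice T j := (h.arc.timeDomain.ordConnected j).out hs ht
  have hac := h.arc.locallyAC j s hs t ht hst.le
  have hc : ContinuousOn (fun r => φ r j) (Icc s t) := by
    simpa [uIcc_of_le hst.le] using hac.continuousOn
  refine ⟨hc, fun r hr => ?_, fun r hr => ?_⟩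
  · refine hasDerivAt_of_ae_of_continuousOn hst.le hac (v := fun r => F (φ r j))
      (hF.comp_continuousOn hc) ?_ hr
    have hint : (interior (slice T j)).Nonempty :=
      ((nonempty_Ioo.2 hst).mono (by
        rw [← interior_Icc]; exact interior_mono hsub))
    have := ae_restrict_of_ae_restrict_of_subset hsub (h.flow_deriv j hint)
    rw [ae_restrict_iff' measurableSet_Icc] at this
    filter_upwards [this] with r hr hr'
    obtain ⟨v, hv, hd⟩ := hr hr'
    rw [hH] at hv
    rwa [mem_singleton_iff.1 hv] at hd
  · exact h.flow_mem j r (hsub ⟨hr.1, hr.2.le⟩) ⟨t, ht, hr.2⟩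

/-- An exponential decay estimate with a compact target gives global asymptotic stability, up to
completeness of maximal solutions. -/
theorem IsExponentiallyStable.basin_eq_univ {A : Set E} (h : IsExponentiallyStable H A)
    (hA : IsCompact A) (hne : A.Nonempty) : basin H A = univ := by
  obtain ⟨γ, hγ, k, hk, h⟩ := h
  refine eq_univ_of_forall fun ξ T φ hφ _ => ⟨?_, fun _ => ?_⟩
  · obtain ⟨R, hR⟩ := hA.isBounded.exists_norm_le
    refine ⟨k * Metric.infDist (φ 0 0) A + R, fun t j htj => ?_⟩
    obtain ⟨Y, hY, hdist⟩ := hA.exists_infDist_eq_dist hne (φ t j)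
    have h1 := h T φ hφ t j htj
    have h2 : Real.exp (-γ * (t + (j : ℝ))) ≤ 1 := by
      rw [Real.exp_le_one_iff]
      have := hφ.arc.timeDomain.nonneg htj
      nlinarith [(Nat.cast_nonneg j : (0 : ℝ) ≤ j), mul_nonneg hγ.le this,
        mul_nonneg hγ.le (Nat.cast_nonneg j : (0 : ℝ) ≤ j)]
    have h3 : k * Real.exp (-γ * (t + (j : ℝ))) * Metric.infDist (φ 0 0) A ≤
        k * 1 * Metric.infDist (φ 0 0) A := by
      gcongr
      exact Metric.infDist_nonneg
    have h4 := norm_le_norm_add_norm_sub' (φ t j) Y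
    rw [← dist_eq_norm] at h4
    linarith [hR Y hY]
  · intro r hr
    set D := Metric.infDist (φ 0 0) A
    have hD : 0 ≤ D := Metric.infDist_nonneg
    have htend : Tendsto (fun S : ℝ => k * Real.exp (-γ * S) * D) atTop (𝓝 0) := by
      have : Tendsto (fun S : ℝ => -γ * S) atTop atBot :=
        tendsto_id.const_mul_atTop_of_neg (by linarith)
      simpa using ((Real.tendsto_exp_atBot.comp this).const_mul k).mul_const D
    obtain ⟨S, hS⟩ := (htend.eventually (ge_mem_nhds hr)).exists
    refine ⟨S, fun t j htj hle => (h T φ hφ t j htj).trans (le_trans ?_ hS)⟩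
    gcongr ?_ * ?_ * ?_
    rw [Real.exp_le_exp]
    nlinarith

theorem IsExponentiallyStable.isStable {A : Set E} (h : IsExponentiallyStable H A) :
    IsStable H A := by
  obtain ⟨γ, hγ, k, hk, h⟩ := h
  refine fun r hr => ⟨r / k, by positivity, fun T φ hφ h0 t j htj => ?_⟩
  refine (h T φ hφ t j htj).trans ?_
  have h2 : Real.exp (-γ * (t + (j : ℝ))) ≤ 1 := by
    rw [Real.exp_le_one_iff]
    have := hφ.arc.timeDomain.nonneg htj
    have : 0 ≤ t + (j : ℝ) := by positivity
    nlinarith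
  have h3 : 0 ≤ Metric.infDist (φ 0 0) A := Metric.infDist_nonneg
  calc _ ≤ k * 1 * (r / k) := by gcongr
    _ = r := by field_simp

theorem IsExponentiallyStable.isGAS {A : Set E} (h : IsExponentiallyStable H A)
    (hA : IsCompact A) (hne : A.Nonempty)
    (hc : ∀ (T : Set (ℝ × ℕ)) (φ : ℝ → ℕ → E), IsSolution H T φ → IsMaximal H T φ →
      IsComplete T) : IsGAS H A := by
  have hb := h.basin_eq_univ hA hne
  refine ⟨⟨h.isStable, hc, 1, one_pos, fun T φ hφ _ => ?_⟩, hb⟩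
  have : φ 0 0 ∈ basin H A := hb ▸ mem_univ _
  exact this T φ hφ rfl

end Solutions

end Hybrid

/-! ### Extension of solutions and completeness of maximal ones. -/

namespace Hybrid

variable {E : Type*} [NormedAddCommGroup E] [NormedSpace ℝ E]

/-- The mean value inequality on the open interval passes to its closure by continuity, so no
derivative at the end points is needed. -/
theorem lipschitzOnWith_Icc_of_hasDerivAt {w v : ℝ → E} {a b : ℝ} {C : NNReal}
    (hw : ContinuousOn w (Icc a b)) (hd : ∀ r ∈ Ioo a b, HasDerivAt w (v r) r)
    (hC : ∀ r ∈ Ioo a b, ‖v r‖₊ ≤ C) : LipschitzOnWith C w (Icc a b) := by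
  rcases le_or_gt b a with hab | hab
  · exact LipschitzOnWith.of_dist_le_mul fun x hx y hy => by
      have : x = y := by linarith [hx.1, hx.2, hy.1, hy.2]
      simp [this]
  · rw [← closure_Ioo hab.ne] at hw ⊢
    rw [lipschitzOnWith_closure_iff hw]
    exact (convex_Ioo a b).lipschitzOnWith_of_nnnorm_hasDerivWithin_le
      (fun r hr => (hd r hr).hasDerivWithinAt) hC

theorem exists_lipschitzOnWith_Icc {w : ℝ → E} {F : E → E} (hF : Continuous F) {a b : ℝ}
    (hw : ContinuousOn w (Icc a b)) (hd : ∀ r ∈ Ioo a b, HasDerivAt w (F (w r)) r) :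
    ∃ C, LipschitzOnWith C w (Icc a b) := by
  obtain ⟨C, hC⟩ := isCompact_Icc.exists_bound_of_continuousOn (hF.comp_continuousOn hw)
  refine ⟨C.toNNReal, lipschitzOnWith_Icc_of_hasDerivAt hw hd fun r hr => ?_⟩
  have := hC r (Ioo_subset_Icc_self hr)
  rw [← NNReal.coe_le_coe, coe_nnnorm]
  exact this.trans (Real.le_coe_toNNReal C)

theorem lipschitzOnWith_Icc_union {α : Type*} [PseudoMetricSpace α] {w : ℝ → α} {a b c : ℝ} {C : NNReal}
    (h1 : LipschitzOnWith C w (Icc a b)) (h2 : LipschitzOnWith C w (Icc b c)) :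
    LipschitzOnWith C w (Icc a c) := by
  have key : ∀ x ∈ Icc a c, ∀ y ∈ Icc a c, x ≤ y → dist (w x) (w y) ≤ C * dist x y := by
    intro x hx y hy hxy
    rcases le_total y b with hyb | hyb
    · exact h1.dist_le_mul x ⟨hx.1, hxy.trans hyb⟩ y ⟨hy.1, hyb⟩
    rcases le_total b x with hbx | hbx
    · exact h2.dist_le_mul x ⟨hbx, hx.2⟩ y ⟨hyb, hy.2⟩
    · have e1 := h1.dist_le_mul x ⟨hx.1, hbx⟩ b ⟨hx.1.trans hbx, le_rfl⟩
      have e2 := h2.dist_le_mul b ⟨le_rfl, hyb.trans hy.2⟩ y ⟨hyb, hy.2⟩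
      have e3 := dist_triangle (w x) (w b) (w y)
      rw [Real.dist_eq, abs_sub_comm, abs_of_nonneg (by linarith)] at e1 e2 ⊢
      linarith [mul_add (C : ℝ) (b - x) (y - b), show b - x + (y - b) = y - x by ring,
        congrArg (fun z => (C : ℝ) * z) (show b - x + (y - b) = y - x by ring)]
  refine LipschitzOnWith.of_dist_le_mul fun x hx y hy => ?_
  rcases le_total x y with h | h
  · exact key x hx y hy h
  · rw [dist_comm, dist_comm x]; exact key y hy x hx h

/-- Local existence for an autonomous Lipschitz differential equation. -/
theorem exists_local_solution [CompleteSpace E] {F : E → E} {K : NNReal} (hF : LipschitzWith K F)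
    (t₀ : ℝ) (X : E) : ∃ δ > 0, ∃ y : ℝ → E, y t₀ = X ∧
      ∀ t ∈ Icc (t₀ - δ) (t₀ + δ), HasDerivWithinAt y (F (y t)) (Icc (t₀ - δ) (t₀ + δ)) t := by
  -- On the unit ball around `X` the field is bounded by `B`; since `B * δ ≤ 1`, the Picard iterates
  -- stay in that ball.
  set B : NNReal := ‖F X‖₊ + K
  set δ : ℝ := 1 / (B + 1)
  have hδ : 0 < δ := by positivity
  refine ⟨δ, hδ, ?_⟩
  have hP : IsPicardLindelof (fun _ : ℝ => F) (tmin := t₀ - δ) (tmax := t₀ + δ)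
      ⟨t₀, by constructor <;> linarith⟩ X 1 0 B K := by
    refine IsPicardLindelof.of_time_independent (fun x hx => ?_) hF.lipschitzOnWith ?_
    · have h1 := hF.dist_le_mul x X
      have h2 : (K : ℝ) * dist x X ≤ K * 1 := by
        gcongr
        simpa using hx
      have h3 := norm_le_norm_add_norm_sub' (F x) (F X)
      rw [← dist_eq_norm] at h3
      simp only [B, NNReal.coe_add, coe_nnnorm]
      linarith
    · simp only [add_sub_cancel_left, sub_sub_cancel, max_self, NNReal.coe_one, NNReal.coe_zero,
        sub_zero, δ]
      rw [mul_one_div, div_le_one (by positivity)]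
      linarith
  exact hP.exists_eq_forall_mem_Icc_hasDerivWithinAt₀

variable {H : System E} {T : Set (ℝ × ℕ)} {φ : ℝ → ℕ → E}

/-- The last interval is replaced by a longer closed one carrying `w`. Asking for a Lipschitz `w`
that satisfies the equation only almost everywhere allows gluing at a point and adding an end point
without any smoothness check there. -/
theorem IsSolution.not_isMaximal_of_flow {F : E → E}
    (hH : ∀ X, H.flowMap X = {F X}) (h : IsSolution H T φ) {t : ℕ → ℝ} {J : ℕ} {L : Set ℝ} {s : ℝ}
    (h0 : t 0 = 0) (hm : Monotone t) (hmem : t J ∈ L)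
    (hT : T = {p | (p.2 < J ∧ p.1 ∈ Icc (t p.2) (t (p.2 + 1))) ∨ (p.2 = J ∧ p.1 ∈ L)})
    (hL : L ⊂ Icc (t J) s) {w : ℝ → E} {C : NNReal} (hw : LipschitzOnWith C w (Icc (t J) s))
    (heq : ∀ r ∈ L, w r = φ r J) (hfl : ∀ r ∈ Ico (t J) s, w r ∈ H.flowSet)
    (hd : ∀ᵐ r, r ∈ Icc (t J) s → HasDerivAt w (F (w r)) r) : ¬ IsMaximal H T φ := by
  classical
  have hs : t J ≤ s := (hL.subset hmem).2
  set T' : Set (ℝ × ℕ) :=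
    {p | (p.2 < J ∧ p.1 ∈ Icc (t p.2) (t (p.2 + 1))) ∨ (p.2 = J ∧ p.1 ∈ Icc (t J) s)}
  set φ' : ℝ → ℕ → E := fun r j => if j = J then w r else φ r j
  have hsub : T ⊆ T' := by
    rw [hT]
    rintro ⟨r, j⟩ (hr | hr)
    · exact Or.inl hr
    · exact Or.inr ⟨hr.1, hL.subset hr.2⟩
  have hagree : ∀ r j, (r, j) ∈ T → φ' r j = φ r j := by
    intro r j hr
    by_cases hj : j = J
    · subst hj
      have : r ∈ L := by
        rw [hT] at hr
        rcases hr with hr | hr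
        · exact absurd hr.1 (lt_irrefl _)
        · exact hr.2
      simp [φ', heq r this]
    · simp [φ', hj]
  have hsl : ∀ j, j ≠ J → slice T' j = slice T j := by
    intro j hj
    ext r
    simp [slice, hT, T', hj]
  have hslJ : slice T' J = Icc (t J) s := by
    ext r
    simp [slice, T']
  have hφ' : ∀ j, j ≠ J → (fun r => φ' r j) = fun r => φ r j := fun j hj => by
    funext r; simp [φ', hj]
  have hφJ : (fun r => φ' r J) = w := by funext r; simp [φ']
  refine not_not.2 ⟨T', φ', ⟨⟨⟨fun k => if k ≤ J then t k else s, by simp [h0], ?_, Or.inr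
    ⟨J, Icc (t J) s, ⟨t J, le_rfl, hs⟩, Or.inl (by simp), ?_⟩⟩, ?_⟩, ?_, ?_, ?_, ?_⟩, ?_, hagree⟩
  · intro k l hkl
    simp only
    split_ifs with h1 h2
    · exact hm hkl
    · exact (hm h1).trans hs
    · omega
    · exact le_rfl
  · ext ⟨r, j⟩
    simp only [T', mem_ofPred_eq]
    refine or_congr (and_congr_right fun hj => ?_) Iff.rfl
    rw [if_pos hj.le, if_pos (Nat.succ_le_of_lt hj)]
  · intro j a ha b hb hab
    by_cases hj : j = J
    · subst hj
      rw [hφJ]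
      rw [hslJ] at ha hb
      refine (hw.mono ?_).absolutelyContinuousOnInterval
      rw [uIcc_of_le hab]
      exact Icc_subset_Icc ha.1 hb.2
    · rw [hφ' j hj]
      rw [hsl j hj] at ha hb
      exact h.arc.locallyAC j a ha b hb hab
  · rw [hagree 0 0 h.arc.timeDomain.zero_mem]
    exact h.start
  · intro j hj
    by_cases hjJ : j = J
    · subst hjJ
      rw [hslJ, ae_restrict_iff' measurableSet_Icc]
      filter_upwards [hd] with r hr hr'
      refine ⟨F (φ' r j), by rw [hH]; rfl, ?_⟩
      rw [hφJ]
      simpa [φ'] using hr hr'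
    · rw [hsl j hjJ] at hj ⊢
      rw [hφ' j hjJ]
      filter_upwards [h.flow_deriv j hj] with r hr
      simpa [φ', hjJ] using hr
  · rintro j r hr ⟨r', hr', hlt⟩
    by_cases hj : j = J
    · subst hj
      rw [hslJ] at hr hr'
      simpa [φ'] using hfl r ⟨hr.1, hlt.trans_le hr'.2⟩
    · rw [hsl j hj] at hr hr'
      simpa [φ', hj] using h.flow_mem j r hr ⟨r', hr', hlt⟩
  · intro r j hr hr1
    have hj : j < J := by
      rcases hr1 with hr1 | hr1
      · have := hr1.1; simp only at this; omega
      · have := hr1.1; simp only at this; omega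
    have m1 : (r, j) ∈ T := by
      change r ∈ slice T j
      rw [← hsl j hj.ne]; exact hr
    have m2 : (r, j + 1) ∈ T := by
      by_cases hj1 : j + 1 = J
      -- At the jump into the enlarged interval, `r` is squeezed to `t J`, which already belonged to
      -- `L`.
      · have e1 : r ≤ t (j + 1) := by
          rcases hr with hr | hr
          · exact hr.2.2
          · exact absurd hr.1 hj.ne
        have e2 : t J ≤ r := by
          rcases hr1 with hr1 | hr1
          · exact absurd hj1 hr1.1.ne
          · exact hr1.2.1
        rw [hj1] at e1
        rw [hT, le_antisymm e1 e2]
        exact Or.inr ⟨hj1, hmem⟩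
      · change r ∈ slice T (j + 1)
        rw [← hsl _ hj1]; exact hr1
    rw [hagree r j m1, hagree r _ m2]
    exact h.jump r j m1 m2
  · refine ⟨hsub, fun hsub' => ?_⟩
    obtain ⟨r, hr, hrL⟩ := exists_of_ssubset hL
    have : (r, J) ∈ T := hsub' (Or.inr ⟨rfl, hr⟩)
    rw [hT] at this
    rcases this with h1 | h1
    · exact lt_irrefl _ h1.1
    · exact hrL h1.2

/-- The extension appends the degenerate interval {s} × {J + 1}: it has empty interior and no later
time, so no flow condition arises on it. -/
theorem IsSolution.not_isMaximal_of_jump (h : IsSolution H T φ) {t : ℕ → ℝ} {J : ℕ}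
    (h0 : t 0 = 0) (hm : Monotone t)
    (hT : T = {p | (p.2 < J ∧ p.1 ∈ Icc (t p.2) (t (p.2 + 1))) ∨
      (p.2 = J ∧ p.1 ∈ Icc (t J) (t (J + 1)))})
    (hj : φ (t (J + 1)) J ∈ H.jumpSet) {Y : E} (hY : Y ∈ H.jumpMap (φ (t (J + 1)) J)) :
    ¬ IsMaximal H T φ := by
  classical
  have hT1 : ∀ r j, (r, j) ∈ T ↔ j ≤ J ∧ r ∈ Icc (t j) (t (j + 1)) := by
    intro r j
    rw [hT]
    simp only [mem_ofPred_eq]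
    constructor
    · rintro (⟨h1, h2⟩ | ⟨rfl, h2⟩)
      · exact ⟨h1.le, h2⟩
      · exact ⟨le_rfl, h2⟩
    · rintro ⟨h1, h2⟩
      rcases h1.lt_or_eq with h1 | rfl
      · exact Or.inl ⟨h1, h2⟩
      · exact Or.inr ⟨rfl, h2⟩
  set s := t (J + 1)
  set T' : Set (ℝ × ℕ) :=
    {p | (p.2 < J + 1 ∧ p.1 ∈ Icc (t p.2) (t (p.2 + 1))) ∨ (p.2 = J + 1 ∧ p.1 ∈ Icc s s)}
  set φ' : ℝ → ℕ → E := fun r j => if j = J + 1 then Y else φ r j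
  have hagree : ∀ r j, (r, j) ∈ T → φ' r j = φ r j := by
    intro r j hr
    have := ((hT1 r j).1 hr).1
    have hj : j ≠ J + 1 := by omega
    simp [φ', hj]
  have hsl : ∀ j, j ≠ J + 1 → slice T' j = slice T j := by
    intro j hj
    ext r
    change (r, j) ∈ T' ↔ (r, j) ∈ T
    rw [hT1]
    simp [T', hj]
  have hslJ : slice T' (J + 1) = {s} := by
    ext r
    simp [slice, T']
  have hφ' : ∀ j, j ≠ J + 1 → (fun r => φ' r j) = fun r => φ r j := fun j hj => by
    funext r; simp [φ', hj]
  refine not_not.2 ⟨T', φ', ⟨⟨⟨fun k => if k ≤ J + 1 then t k else s, by simp [h0], ?_, Or.inr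
    ⟨J + 1, Icc s s, ⟨s, le_rfl, le_rfl⟩, Or.inl (by simp [s]), ?_⟩⟩, ?_⟩, ?_, ?_, ?_, ?_⟩, ?_,
    hagree⟩
  · intro k l hkl
    simp only
    split_ifs with h1 h2
    · exact hm hkl
    · exact hm h1
    · omega
    · exact le_rfl
  · ext ⟨r, j⟩
    simp only [T', mem_ofPred_eq]
    refine or_congr (and_congr_right fun hj => ?_) Iff.rfl
    rw [if_pos hj.le, if_pos (Nat.succ_le_of_lt hj)]
  · intro j a ha b hb hab
    by_cases hj : j = J + 1
    · subst hj
      have hc : (fun r => φ' r (J + 1)) = fun _ => Y := by funext r; simp [φ']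
      rw [hc]
      exact ((LipschitzWith.const Y).lipschitzOnWith).absolutelyContinuousOnInterval
    · rw [hφ' j hj]
      rw [hsl j hj] at ha hb
      exact h.arc.locallyAC j a ha b hb hab
  · rw [hagree 0 0 h.arc.timeDomain.zero_mem]
    exact h.start
  · intro j hj
    by_cases hjJ : j = J + 1
    · subst hjJ
      rw [hslJ, interior_singleton] at hj
      exact absurd hj not_nonempty_empty
    · rw [hsl j hjJ] at hj ⊢
      rw [hφ' j hjJ]
      filter_upwards [h.flow_deriv j hj] with r hr
      simpa [φ', hjJ] using hr
  · rintro j r hr ⟨r', hr', hlt⟩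
    by_cases hj : j = J + 1
    · subst hj
      rw [hslJ] at hr hr'
      rw [mem_singleton_iff.1 hr, mem_singleton_iff.1 hr'] at hlt
      exact absurd hlt (lt_irrefl _)
    · rw [hsl j hj] at hr hr'
      simpa [φ', hj] using h.flow_mem j r hr ⟨r', hr', hlt⟩
  · intro r j hr hr1
    by_cases hj1 : j = J
    · subst hj1
      have e : r = s := by
        have : r ∈ slice T' (j + 1) := hr1
        rwa [hslJ, mem_singleton_iff] at this
      subst e
      simpa [φ'] using And.intro hj hY
    · have hj2 : j < J := by
        rcases hr1 with hr1 | hr1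
        · have := hr1.1; simp only at this; omega
        · have := hr1.1; simp only at this; omega
      have m1 : (r, j) ∈ T := by
        change r ∈ slice T j
        rw [← hsl j (by omega)]; exact hr
      have m2 : (r, j + 1) ∈ T := by
        change r ∈ slice T (j + 1)
        rw [← hsl _ (by omega)]; exact hr1
      rw [hagree r j m1, hagree r _ m2]
      exact h.jump r j m1 m2
  · refine ⟨?_, fun hsub' => ?_⟩
    · rintro ⟨r, j⟩ hr
      have hj := ((hT1 r j).1 hr).1
      change r ∈ slice T' j
      rw [hsl j (by omega)]; exact hr
    · have : (s, J + 1) ∈ T := hsub' (Or.inr ⟨rfl, le_rfl, le_rfl⟩)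
      have := ((hT1 _ _).1 this).1
      omega

/-- Completeness of maximal solutions: no finite escape and viability. -/
theorem IsSolution.isComplete_of_isMaximal [FiniteDimensional ℝ E] {F : E → E} {K : NNReal}
    (hF : LipschitzWith K F) (hH : ∀ X, H.flowMap X = {F X}) {V : Set E}
    (hV : ∀ t j, (t, j) ∈ T → φ t j ∈ V) (hbd : IsBoundedArc T φ)
    (hjump : ∀ X ∈ H.jumpSet, (H.jumpMap X).Nonempty)
    (hviab : ∀ X ∈ V, X ∉ H.jumpSet → ∀ (t : ℝ) (y : ℝ → E), y t = X →
      HasDerivWithinAt y (F X) (Ici t) t → ∀ᶠ s in 𝓝[≥] t, y s ∈ H.flowSet)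
    (h : IsSolution H T φ) (hmax : IsMaximal H T φ) : IsComplete T := by
  have : CompleteSpace E := FiniteDimensional.complete ℝ E
  have : ProperSpace E := FiniteDimensional.proper ℝ E
  intro hb
  obtain ⟨t, J, L, h0, hm, hmem, hL, hT⟩ := h.arc.timeDomain.exists_of_isBounded hb
  have hslJ : slice T J = L := by
    ext r
    simp [slice, hT]
  rcases hL with rfl | rfl
  · set s := t (J + 1)
    have hs : t J ≤ s := hm J.le_succ
    have hsT : (s, J) ∈ T := by
      change s ∈ slice T J
      rw [hslJ]; exact ⟨hs, le_rfl⟩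
    -- When the last interval is closed, its end point can either jump or, by viability, be
    -- continued by a local solution of the differential equation.
    by_cases hD : φ s J ∈ H.jumpSet
    · exact h.not_isMaximal_of_jump h0 hm hT hD (hjump _ hD).some_mem hmax
    obtain ⟨δ, hδ, y, hy0, hy⟩ := exists_local_solution hF s (φ s J)
    have hys : HasDerivAt y (F (φ s J)) s := by
      have := (hy s ⟨by linarith, by linarith⟩).hasDerivAt
        (Icc_mem_nhds (by linarith) (by linarith))
      rwa [hy0] at this
    have hev := hviab _ (hV s J hsT) hD s y hy0 hys.hasDerivWithinAt
    obtain ⟨u, hu, hu'⟩ := (mem_nhdsGE_iff_exists_Ico_subset' (lt_add_of_pos_right s hδ)).1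
      (inter_mem hev (Ico_mem_nhdsGE (lt_add_of_pos_right s hδ)))
    have hsu : s < u := hu
    have hyder : ∀ r ∈ Ioo s u, HasDerivAt y (F (y r)) r := by
      intro r hr
      have := (hu' ⟨hr.1.le, hr.2⟩).2.2
      exact (hy r ⟨by linarith [hr.1], this.le⟩).hasDerivAt
        (Icc_mem_nhds (by linarith [hr.1]) this)
    have huδ : u ≤ s + δ := by
      by_contra! hcon
      exact lt_irrefl _ (hu' ⟨by linarith, hcon⟩).2.2
    have hycont : ContinuousOn y (Icc s u) := fun r hr =>
      ((hy r ⟨by linarith [hr.1], hr.2.trans huδ⟩).continuousWithinAt).mono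
        (Icc_subset_Icc (by linarith) huδ)
    set w : ℝ → E := fun r => if r ≤ s then φ r J else y r
    have hw1 : ∀ r ≤ s, w r = φ r J := fun r hr => by simp [w, hr]
    have hw2 : ∀ r, s ≤ r → w r = y r := by
      intro r hr
      rcases hr.eq_or_lt with rfl | hr
      · simp [w, hy0]
      · simp [w, hr.not_ge]
    have hseg : t J < s → _ := fun hlt => h.flow_segment hF.continuous hH (j := J)
      (by rw [hslJ]; exact hmem) (by rw [hslJ]; exact ⟨hs, le_rfl⟩) hlt
    obtain ⟨C1, hC1⟩ : ∃ C, LipschitzOnWith C w (Icc (t J) s) := by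
      rcases hs.eq_or_lt with heq | hlt
      · rw [heq]
        exact ⟨0, by simp⟩
      · obtain ⟨hc, hd, -⟩ := hseg hlt
        obtain ⟨C, hC⟩ := exists_lipschitzOnWith_Icc hF.continuous hc hd
        exact ⟨C, fun a ha b hb => by rw [hw1 a ha.2, hw1 b hb.2]; exact hC ha hb⟩
    obtain ⟨C2, hC2⟩ : ∃ C, LipschitzOnWith C w (Icc s u) := by
      obtain ⟨C, hC⟩ := exists_lipschitzOnWith_Icc hF.continuous hycont hyder
      exact ⟨C, fun a ha b hb => by rw [hw2 a ha.1, hw2 b hb.1]; exact hC ha hb⟩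
    have hder : ∀ r ∈ Ioo (t J) u, r ≠ s → HasDerivAt w (F (w r)) r := by
      intro r hr hrs
      rcases lt_or_gt_of_ne hrs with hlt | hgt
      · have := (hseg (hr.1.trans hlt)).2.1 r ⟨hr.1, hlt⟩
        rw [hw1 r hlt.le]
        refine this.congr_of_eventuallyEq ?_
        filter_upwards [Iio_mem_nhds hlt] with r' hr'
        exact hw1 r' (le_of_lt hr')
      · rw [hw2 r hgt.le]
        refine (hyder r ⟨hgt, hr.2⟩).congr_of_eventuallyEq ?_
        filter_upwards [Ioi_mem_nhds hgt] with r' hr'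
        exact hw2 r' (le_of_lt hr')
    refine h.not_isMaximal_of_flow hH h0 hm hmem hT (s := u) (w := w) (C := max C1 C2) ?_
      (lipschitzOnWith_Icc_union (hC1.weaken (le_max_left _ _)) (hC2.weaken (le_max_right _ _)))
      (fun r hr => hw1 r hr.2) ?_ ?_ hmax
    · refine ⟨Icc_subset_Icc_right hsu.le, fun hsub => ?_⟩
      exact absurd (hsub ⟨hs.trans hsu.le, le_rfl⟩).2 (not_le.2 hsu)
    · intro r hr
      rcases lt_or_ge r s with hlt | hge
      · rw [hw1 r hlt.le]
        exact (hseg (hr.1.trans_lt hlt)).2.2 r ⟨hr.1, hlt⟩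
      · rw [hw2 r hge]
        exact (hu' ⟨hge, hr.2⟩).1
    -- The equation may fail only at the two end points and at the gluing time, a null set.
    · filter_upwards [compl_mem_ae_iff.2 (measure_singleton (t J)),
        compl_mem_ae_iff.2 (measure_singleton s), compl_mem_ae_iff.2 (measure_singleton u)]
        with r h1 h2 h3 hr
      exact hder r ⟨lt_of_le_of_ne hr.1 (Ne.symm h1), lt_of_le_of_ne hr.2 h3⟩ h2
  · set s := t (J + 1)
    have hs : t J < s := hmem.2
    have hseg : ∀ a ∈ Ico (t J) s, ∀ b ∈ Ico (t J) s, a < b → _ := fun a ha b hb hab =>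
      h.flow_segment hF.continuous hH (j := J) (by rw [hslJ]; exact ha) (by rw [hslJ]; exact hb) hab
    obtain ⟨M, hM⟩ := hbd
    -- When the last interval is half-open, a bounded arc has bounded velocity; it is therefore
    -- Lipschitz and extends to the missing end point.
    obtain ⟨C, hC⟩ := (isCompact_closedBall (0 : E) M).exists_bound_of_continuousOn
      hF.continuous.continuousOn
    have hlip : LipschitzOnWith C.toNNReal (fun r => φ r J) (Ico (t J) s) := by
      have key : ∀ a ∈ Ico (t J) s, ∀ b ∈ Ico (t J) s, a < b →
          dist (φ a J) (φ b J) ≤ C.toNNReal * dist a b := by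
        intro a ha b hb hab
        obtain ⟨hc, hd, -⟩ := hseg a ha b hb hab
        have := lipschitzOnWith_Icc_of_hasDerivAt (C := C.toNNReal) hc hd fun r hr => by
          have hrT : (r, J) ∈ T := by
            change r ∈ slice T J
            rw [hslJ]; exact ⟨ha.1.trans hr.1.le, hr.2.trans hb.2⟩
          have := hC (φ r J) (by simpa using hM r J hrT)
          rw [← NNReal.coe_le_coe, coe_nnnorm]
          exact this.trans (Real.le_coe_toNNReal C)
        exact this.dist_le_mul a ⟨le_rfl, hab.le⟩ b ⟨hab.le, le_rfl⟩
      refine LipschitzOnWith.of_dist_le_mul fun a ha b hb => ?_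
      rcases lt_trichotomy a b with hab | rfl | hab
      · exact key a ha b hb hab
      · simp
      · rw [dist_comm, dist_comm a]; exact key b hb a ha hab
    obtain ⟨w, hw, heq⟩ := hlip.extend_finite_dimension
    refine h.not_isMaximal_of_flow hH h0 hm hmem hT (s := s) (w := w) ?_ hw.lipschitzOnWith
      (fun r hr => (heq hr).symm) ?_ ?_ hmax
    · refine ⟨Ico_subset_Icc_self, fun hsub => ?_⟩
      exact lt_irrefl _ (hsub ⟨hs.le, le_rfl⟩).2
    · intro r hr
      rw [← heq hr]
      obtain ⟨b, hb1, hb2⟩ := exists_between hr.2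
      exact (hseg r hr b ⟨hr.1.trans hb1.le, hb2⟩ hb1).2.2 r ⟨le_rfl, hb1⟩
    · filter_upwards [compl_mem_ae_iff.2 (measure_singleton (t J)),
        compl_mem_ae_iff.2 (measure_singleton s)] with r h1 h2 hr
      have hr1 : t J < r := lt_of_le_of_ne hr.1 (Ne.symm h1)
      have hr2 : r < s := lt_of_le_of_ne hr.2 h2
      obtain ⟨b, hb1, hb2⟩ := exists_between hr2
      have := (hseg (t J) hmem b ⟨hr1.le.trans hb1.le, hb2⟩ (hr1.trans hb1)).2.1 r ⟨hr1, hb1⟩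
      rw [← heq ⟨hr1.le, hr2⟩]
      refine this.congr_of_eventuallyEq ?_
      filter_upwards [Ioo_mem_nhds hr1 hr2] with r' hr'
      exact (heq ⟨hr'.1.le, hr'.2⟩).symm

end Hybrid

namespace TLazy

/-! ### Quadratic forms and induced norms of matrices. -/

section MatrixEstimates

variable {m k : ℕ}

open scoped Matrix.Norms.L2Operator in
theorem opNorm_nonneg (M : Matrix (Fin m) (Fin k) ℝ) : 0 ≤ opNorm M :=
  norm_nonneg M

theorem norm_act_le (M : Matrix (Fin m) (Fin k) ℝ) (v : EuclideanSpace ℝ (Fin k)) :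
    ‖act M v‖ ≤ opNorm M * ‖v‖ :=
  Matrix.l2_opNorm_mulVec M v

theorem opNorm_pos {M : Matrix (Fin m) (Fin k) ℝ} (hM : M ≠ 0) : 0 < opNorm M := by
  refine (opNorm_nonneg M).lt_of_ne' fun h => hM ?_
  ext i j
  have h1 := norm_act_le M (EuclideanSpace.single j 1)
  rw [h, zero_mul] at h1
  have h2 := norm_le_zero_iff.1 h1
  have h3 := congrArg (fun v : EuclideanSpace ℝ (Fin m) => v i) h2
  simpa using h3

theorem dotProduct_eq_inner (v w : EuclideanSpace ℝ (Fin k)) :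
    v.ofLp ⬝ᵥ w.ofLp = inner ℝ v w := by
  rw [EuclideanSpace.inner_eq_star_dotProduct, dotProduct_comm]
  simp

theorem abs_dotProduct_mulVec_le (M : Matrix (Fin m) (Fin k) ℝ) (v : EuclideanSpace ℝ (Fin m))
    (w : EuclideanSpace ℝ (Fin k)) : |v.ofLp ⬝ᵥ M *ᵥ w.ofLp| ≤ opNorm M * ‖v‖ * ‖w‖ := by
  have h1 : v.ofLp ⬝ᵥ M *ᵥ w.ofLp = inner ℝ v (act M w) := dotProduct_eq_inner v (act M w)
  rw [h1]
  calc _ ≤ ‖v‖ * ‖act M w‖ := abs_real_inner_le_norm _ _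
    _ ≤ ‖v‖ * (opNorm M * ‖w‖) := by gcongr; exact norm_act_le M w
    _ = _ := by ring

/-- The form attains a positive minimum on the compact unit sphere, and homogeneity does the rest.
The sphere is empty in dimension zero. -/
theorem exists_le_dotProduct_mulVec {M : Matrix (Fin k) (Fin k) ℝ} (hM : M.PosDef) :
    ∃ c > 0, ∀ x : EuclideanSpace ℝ (Fin k), c * ‖x‖ ^ 2 ≤ x.ofLp ⬝ᵥ M *ᵥ x.ofLp := by
  have hcont : Continuous fun x : EuclideanSpace ℝ (Fin k) => x.ofLp ⬝ᵥ M *ᵥ x.ofLp := by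
    have h := PiLp.continuous_ofLp 2 (fun _ : Fin k => ℝ)
    exact h.dotProduct (continuous_const.matrix_mulVec h)
  have hpos : ∀ x : EuclideanSpace ℝ (Fin k), x ≠ 0 → 0 < x.ofLp ⬝ᵥ M *ᵥ x.ofLp := by
    intro x hx
    have := hM.dotProduct_mulVec_pos (x := x.ofLp) (by simpa using hx)
    simpa using this
  rcases (Metric.sphere (0 : EuclideanSpace ℝ (Fin k)) 1).eq_empty_or_nonempty with he | hne
  · refine ⟨1, one_pos, fun x => ?_⟩
    have : x = 0 := by
      by_contra hx
      have : (‖x‖⁻¹ • x) ∈ Metric.sphere (0 : EuclideanSpace ℝ (Fin k)) 1 := by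
        simp [norm_smul, hx]
      rw [he] at this
      exact this
    simp [this]
  · obtain ⟨y, hy, hmin⟩ := (isCompact_sphere (0 : EuclideanSpace ℝ (Fin k)) 1).exists_isMinOn hne
      hcont.continuousOn
    have hy1 : ‖y‖ = 1 := by simpa using hy
    refine ⟨_, hpos y (by rintro rfl; simp at hy1), fun x => ?_⟩
    by_cases hx : x = 0
    · simp [hx]
    have hx' : 0 < ‖x‖ := norm_pos_iff.2 hx
    have h1 : (‖x‖⁻¹ • x) ∈ Metric.sphere (0 : EuclideanSpace ℝ (Fin k)) 1 := by
      simp [norm_smul, hx]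
    have h2 := hmin h1
    simp only [mem_ofPred_eq, WithLp.ofLp_smul, Matrix.mulVec_smul, smul_dotProduct,
      dotProduct_smul, smul_eq_mul] at h2
    calc _ ≤ (‖x‖⁻¹ * (‖x‖⁻¹ * (x.ofLp ⬝ᵥ M *ᵥ x.ofLp))) * ‖x‖ ^ 2 := by gcongr
      _ = _ := by field_simp

theorem mulVec_ne_zero_of_rank_eq {M : Matrix (Fin m) (Fin k) ℝ} (hM : M.rank = k)
    {v : Fin k → ℝ} (hv : v ≠ 0) : M *ᵥ v ≠ 0 := by
  have h := LinearMap.finrank_range_add_finrank_ker M.mulVecLin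
  rw [show Module.finrank ℝ (LinearMap.range M.mulVecLin) = k from hM] at h
  simp only [Module.finrank_fintype_fun_eq_card, Fintype.card_fin, Nat.add_eq_left] at h
  have hker : LinearMap.ker M.mulVecLin = ⊥ := Submodule.finrank_eq_zero.1 h
  intro h0
  have : v ∈ LinearMap.ker M.mulVecLin := by simpa using h0
  rw [hker] at this
  exact hv (by simpa using this)

end MatrixEstimates

/-! ### The algebraic inequality behind the decay along flows. -/

theorem cross_term_le {μ f k β X Y W : ℝ} (hf : 0 ≤ f) (hμ : 0 ≤ μ) (hX : 0 ≤ X) (hW : 0 ≤ W)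
    (hμf : μ * (4 * f * k ^ 2) ≤ β / 4) (h1 : W ≤ k * (X + Y)) (h2 : X + W ≤ k * (X + Y)) :
    2 * μ * f * W * (X + W) ≤ β / 4 * (X ^ 2 + Y ^ 2) := by
  have h0 : 0 ≤ k * (X + Y) := hW.trans h1
  have hβ : 0 ≤ β / 4 := le_trans (by positivity) hμf
  calc 2 * μ * f * W * (X + W) = 2 * μ * f * (W * (X + W)) := by ring
    _ ≤ 2 * μ * f * ((k * (X + Y)) * (k * (X + Y))) := by gcongr
    _ = μ * (4 * f * k ^ 2) * ((X + Y) ^ 2 / 2) := by ring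
    _ ≤ β / 4 * ((X + Y) ^ 2 / 2) := by gcongr
    _ ≤ β / 4 * (X ^ 2 + Y ^ 2) := by
      gcongr
      linarith [sq_nonneg (X - Y), add_sq X Y, sub_sq X Y]

/-- Young's inequality, from the square of X/2 - aY/β. -/
theorem mul_le_quarter_sq_add {β a X Y : ℝ} (hβ : 0 < β) :
    a * X * Y ≤ β / 4 * X ^ 2 + a ^ 2 / β * Y ^ 2 := by
  have h1 : a ^ 2 / β * Y ^ 2 = β * (a * Y / β) ^ 2 := by field_simp
  have h2 : a * X * Y = β * (X * (a * Y / β)) := by field_simp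
  rw [h1, h2]
  have := mul_nonneg hβ.le (sq_nonneg (X / 2 - a * Y / β))
  linarith

/-- The estimate behind the decrease of the Lyapunov function along flows: the errors outside `R`
are controlled by the plant state, those in `R` by the decreasing weights. -/
theorem exists_decay_constants {q : ℕ} {β a κ f l : ℝ} (hβ : 0 < β) (hκ : 0 ≤ κ)
    (hf : 0 ≤ f) (hl : 0 < l) :
    ∃ μ > 0, ∃ M > 0, ∃ r > 0, ∀ (X P P' : ℝ) (E D m g : Fin q → ℝ) (R : Fin q → Prop)
      [DecidablePred R], 0 ≤ X → (∀ i, 0 ≤ E i) → (∀ i, μ / 3 ≤ m i) → (∀ i, m i ≤ μ) →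
      (∀ i, ¬ R i → E i ≤ κ * X) → (∀ i, 0 ≤ g i) → (∀ i, R i → g i = M) →
      (∀ i, |D i| ≤ f * (X + ∑ j, E j)) → P ≤ l * X ^ 2 →
      P' ≤ -β * X ^ 2 + a * X * ∑ i, (if R i then E i else 0) →
      P' + ∑ i, m i * (2 * E i * |D i| - g i * E i ^ 2) ≤ -r * (P + ∑ i, m i * E i ^ 2) := by
  -- With `W` the sum of all errors and `Y` that of the errors in `R`, W ≤ qκX + Y, so `k` serves
  -- both `W` and X + W.
  set k : ℝ := 1 + q * κ with hk
  have hk1 : 1 ≤ k := by have : 0 ≤ q * κ := by positivity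
                         linarith
  -- Small enough that the growth of all errors costs at most β/4 (X² + Y²); the added 1 keeps the
  -- quotient meaningful when f = 0.
  set μ : ℝ := β / (4 * (4 * f * k ^ 2 + 1)) with hμ
  have hμ0 : 0 < μ := by positivity
  have hμf : μ * (4 * f * k ^ 2) ≤ β / 4 := by
    rw [hμ, div_mul_eq_mul_div, div_le_div_iff₀ (by positivity) (by norm_num)]
    linarith
  -- Since the weights are at least μ/3, this gain absorbs every Y² term through Y² ≤ qZ and still
  -- leaves -Z, where `Z` is the sum of the squared errors in `R`.
  set M : ℝ := 3 / μ * ((a ^ 2 / β + β / 4) * q + 1) with hM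
  have hM0 : 0 < M := by positivity
  -- The full function is at most l'X² + 2μZ; `r` is the largest rate for which r times this bound
  -- stays below the available β/2 X² + Z.
  set l' : ℝ := l + 2 * q * κ ^ 2 * μ with hl'
  have hl0 : 0 < l' := by positivity
  set r : ℝ := min (β / 2 / l') (1 / (2 * μ)) with hr
  have hr0 : 0 < r := lt_min (by positivity) (by positivity)
  refine ⟨μ, hμ0, M, hM0, r, hr0, ?_⟩
  have hr1 : r ≤ β / 2 / l' := min_le_left _ _
  have hr2 : r ≤ 1 / (2 * μ) := min_le_right _ _
  clear_value r l' M μ k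
  intro X P P' E D m g R _ hX hE hm1 hm2 hN hg hgR hD hP hP'
  set y : Fin q → ℝ := fun i => if R i then E i else 0 with hy
  have hy0 : ∀ i, 0 ≤ y i := fun i => by simp only [hy]; split_ifs; exacts [hE i, le_rfl]
  set Y := ∑ i, y i with hY
  set Z := ∑ i, y i ^ 2 with hZ
  have hY0 : 0 ≤ Y := Finset.sum_nonneg fun i _ => hy0 i
  have hZ0 : 0 ≤ Z := Finset.sum_nonneg fun i _ => sq_nonneg _
  have hYZ : Y ^ 2 ≤ q * Z := by
    simpa using sq_sum_le_card_mul_sum_sq (s := (Finset.univ : Finset (Fin q))) (f := y)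
  have hEy : ∀ i, E i ≤ κ * X + y i := by
    intro i
    by_cases hi : R i
    · simp only [hy, hi, if_true]; nlinarith [mul_nonneg hκ hX]
    · simpa [hy, hi] using hN i hi
  set W := ∑ i, E i with hW
  have hW0 : 0 ≤ W := Finset.sum_nonneg fun i _ => hE i
  have hWk : W ≤ q * κ * X + Y := by
    have := Finset.sum_le_sum fun i (_ : i ∈ Finset.univ) => hEy i
    rw [Finset.sum_add_distrib, Finset.sum_const, Finset.card_univ, Fintype.card_fin,
      nsmul_eq_mul] at this
    linarith
  have hE2 : ∑ i, E i ^ 2 ≤ 2 * q * κ ^ 2 * X ^ 2 + 2 * Z := by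
    have : ∀ i ∈ Finset.univ, E i ^ 2 ≤ 2 * κ ^ 2 * X ^ 2 + 2 * y i ^ 2 := by
      intro i _
      have h1 : E i ^ 2 ≤ (κ * X + y i) ^ 2 := pow_le_pow_left₀ (hE i) (hEy i) 2
      linarith [sq_nonneg (κ * X - y i), add_sq (κ * X) (y i), sub_sq (κ * X) (y i),
        mul_pow κ X 2]
    have := Finset.sum_le_sum this
    rw [Finset.sum_add_distrib, Finset.sum_const, Finset.card_univ, Fintype.card_fin,
      nsmul_eq_mul, ← Finset.mul_sum] at this
    linarith
  have hterm : ∑ i, m i * (2 * E i * |D i| - g i * E i ^ 2) ≤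
      2 * μ * f * W * (X + W) - M * μ / 3 * Z := by
    have : ∀ i ∈ Finset.univ, m i * (2 * E i * |D i| - g i * E i ^ 2) ≤
        2 * μ * f * (X + W) * E i - M * μ / 3 * y i ^ 2 := by
      intro i _
      have hmi : 0 ≤ m i := le_trans (by positivity) (hm1 i)
      have h1 : m i * (2 * E i * |D i|) ≤ μ * (2 * E i * (f * (X + W))) := by
        have := hE i
        gcongr
        · exact hm2 i
        · exact hD i
      have h2 : M * μ / 3 * y i ^ 2 ≤ m i * (g i * E i ^ 2) := by
        by_cases hi : R i
        · simp only [hy, hi, if_true, hgR i hi]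
          have : μ / 3 * (M * E i ^ 2) ≤ m i * (M * E i ^ 2) := by
            gcongr
            exact hm1 i
          linarith
        · simp only [hy, hi, if_false]
          have := hg i
          have : 0 ≤ m i * (g i * E i ^ 2) := by positivity
          linarith
      linarith
    have := Finset.sum_le_sum this
    rw [Finset.sum_sub_distrib, ← Finset.mul_sum, ← Finset.mul_sum] at this
    linarith
  have hP'' : P' ≤ -β * X ^ 2 + a * X * Y := hP'
  clear_value W Z Y y
  have hWW : 2 * μ * f * W * (X + W) ≤ β / 4 * (X ^ 2 + Y ^ 2) := by
    have hk' : k * (X + Y) = X + Y + q * κ * X + q * κ * Y := by rw [hk]; ring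
    have hY' : 0 ≤ q * κ * Y := by positivity
    exact cross_term_le hf hμ0.le hX hW0 hμf (by linarith) (by linarith)
  have haXY : a * X * Y ≤ β / 4 * X ^ 2 + a ^ 2 / β * Y ^ 2 := mul_le_quarter_sq_add hβ
  have hMZ : (a ^ 2 / β + β / 4) * Y ^ 2 - M * μ / 3 * Z ≤ -Z := by
    have h1 : M * μ / 3 = (a ^ 2 / β + β / 4) * q + 1 := by rw [hM]; field_simp
    have h2 : (a ^ 2 / β + β / 4) * Y ^ 2 ≤ (a ^ 2 / β + β / 4) * (q * Z) := by gcongr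
    rw [h1]
    linarith
  have hV : P + ∑ i, m i * E i ^ 2 ≤ l' * X ^ 2 + 2 * μ * Z := by
    have h1 : ∑ i, m i * E i ^ 2 ≤ μ * ∑ i, E i ^ 2 := by
      rw [Finset.mul_sum]
      gcongr with i
      exact hm2 i
    have h2 : μ * ∑ i, E i ^ 2 ≤ μ * (2 * q * κ ^ 2 * X ^ 2 + 2 * Z) := by gcongr
    rw [hl']
    linarith
  have hrV : r * (P + ∑ i, m i * E i ^ 2) ≤ β / 2 * X ^ 2 + Z := by
    calc r * (P + ∑ i, m i * E i ^ 2) ≤ r * (l' * X ^ 2 + 2 * μ * Z) := by gcongr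
      _ = r * l' * X ^ 2 + r * (2 * μ) * Z := by ring
      _ ≤ β / 2 / l' * l' * X ^ 2 + 1 / (2 * μ) * (2 * μ) * Z := by
        gcongr
      _ = β / 2 * X ^ 2 + Z := by field_simp
  linarith

end TLazy

/-! ### Scalar differentiation and a Grönwall estimate. -/

section ScalarCalculus

/-- Squaring removes the corner of the positive part: the derivative extends continuously across
zero. Both the timer phase and the timer penalty are built from this function. -/
theorem hasDerivAt_max_zero_sq (s : ℝ) : HasDerivAt (fun s : ℝ => max s 0 ^ 2) (2 * max s 0) s := by
  have key : ∀ s : ℝ, s ≠ 0 → HasDerivAt (fun s : ℝ => max s 0 ^ 2) (2 * max s 0) s := by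
    intro s hs
    rcases lt_or_gt_of_ne hs with h | h
    · rw [max_eq_right h.le, mul_zero]
      refine (hasDerivAt_const s (0 : ℝ)).congr_of_eventuallyEq ?_
      filter_upwards [Iio_mem_nhds h] with r hr
      simp [max_eq_right (le_of_lt (mem_Iio.1 hr))]
    · rw [max_eq_left h.le]
      have h1 : HasDerivAt (fun s : ℝ => s ^ 2) (2 * s) s := by simpa using hasDerivAt_pow 2 s
      refine h1.congr_of_eventuallyEq ?_
      filter_upwards [Ioi_mem_nhds h] with r hr
      simp [max_eq_left (le_of_lt (mem_Ioi.1 hr))]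
  by_cases hs : s = 0
  · subst hs
    exact hasDerivAt_of_hasDerivAt_of_ne (g := fun s => 2 * max s 0) key (by fun_prop) (by fun_prop)
  · exact key s hs

theorem le_exp_mul_of_deriv_le {f f' : ℝ → ℝ} {r s t : ℝ} (hst : s ≤ t)
    (hc : ContinuousOn f (Icc s t)) (hd : ∀ u ∈ Ioo s t, HasDerivAt f (f' u) u)
    (hle : ∀ u ∈ Ioo s t, f' u ≤ -r * f u) : f t ≤ Real.exp (-r * (t - s)) * f s := by
  have hanti : AntitoneOn (fun u => Real.exp (r * (u - s)) * f u) (Icc s t) := by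
    have hder : ∀ u ∈ Ioo s t, HasDerivAt (fun u => Real.exp (r * (u - s)) * f u)
        (Real.exp (r * (u - s)) * r * f u + Real.exp (r * (u - s)) * f' u) u := by
      intro u hu
      have h1 : HasDerivAt (fun u : ℝ => r * (u - s)) r u := by
        simpa using ((hasDerivAt_id u).sub_const s).const_mul r
      exact h1.exp.mul (hd u hu)
    refine antitoneOn_of_deriv_nonpos (convex_Icc s t) ?_ ?_ ?_
    · exact (Continuous.continuousOn (by fun_prop)).mul hc
    · rw [interior_Icc]
      exact fun u hu => (hder u hu).differentiableAt.differentiableWithinAt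
    · rw [interior_Icc]
      intro u hu
      rw [(hder u hu).deriv]
      have := mul_nonneg (Real.exp_pos (r * (u - s))).le (sub_nonneg.2 (hle u hu))
      linarith
  have h := hanti ⟨le_rfl, hst⟩ ⟨hst, le_rfl⟩ hst
  simp only [sub_self, mul_zero, Real.exp_zero, one_mul] at h
  calc f t = Real.exp (-r * (t - s)) * (Real.exp (r * (t - s)) * f t) := by
        rw [← mul_assoc, ← Real.exp_add]; simp
    _ ≤ _ := by gcongr

end ScalarCalculus

namespace TLazy

/-! ### The deadzone and the resulting timer rates. -/

section Deadzone

/-- This form exhibits the deadzone as a sum of clipped translations, hence Lipschitz. -/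
theorem dz_eq (s : ℝ) : dz s = max (s - 1) 0 + min (s + 1) 0 := by
  unfold dz
  split_ifs with h
  · rw [abs_le] at h
    rw [max_eq_right (by linarith), min_eq_right (by linarith), add_zero]
  · rw [not_le, lt_abs] at h
    rcases h with h | h
    · rw [Real.sign_of_pos (by linarith), abs_of_pos (by linarith), max_eq_left (by linarith),
        min_eq_right (by linarith)]
      ring
    · rw [Real.sign_of_neg (by linarith), abs_of_neg (by linarith), max_eq_right (by linarith),
        min_eq_left (by linarith)]
      ring

theorem lipschitzWith_dz : ∃ K, LipschitzWith K dz := by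
  have h1 : LipschitzWith 1 fun s : ℝ => s - 1 :=
    LipschitzWith.of_dist_le_mul fun x y => by simp
  have h2 : LipschitzWith 1 fun s : ℝ => s + 1 :=
    LipschitzWith.of_dist_le_mul fun x y => by simp
  rw [funext dz_eq]
  exact ⟨_, (h1.max_const 0).add (h2.min_const 0)⟩

theorem dz_nonneg {s : ℝ} (hs : 0 ≤ s) : 0 ≤ dz s := by
  rw [dz_eq, min_eq_right (by linarith), add_zero]
  exact le_max_right _ _

theorem dz_div_of_le {s ρ : ℝ} (hρ : 0 < ρ) (hs : 0 ≤ s) (h : s ≤ ρ) : dz (s / ρ) = 0 := by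
  have h0 : 0 ≤ s / ρ := by positivity
  have h1 : s / ρ ≤ 1 := (div_le_one hρ).2 h
  rw [dz_eq, max_eq_right (by linarith), min_eq_right (by linarith), add_zero]

theorem dz_div_of_ge {s ρ : ℝ} (hρ : 0 < ρ) (h : ρ ≤ s) : dz (s / ρ) = s / ρ - 1 := by
  have h1 : 1 ≤ s / ρ := (one_le_div hρ).2 h
  rw [dz_eq, max_eq_left (by linarith), min_eq_right (by linarith), add_zero]

end Deadzone

/-! ### The timer phase entering the error weights. -/

section TimerPhase

/-- A continuously differentiable function of the timer with slope one up to `Δ` that is constant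
from `ρ` on. -/
def timerPhase (Δ ρ s : ℝ) : ℝ :=
  (ρ + Δ) / 2 - (max (ρ - s) 0 ^ 2 - max (Δ - s) 0 ^ 2) / (2 * (ρ - Δ))

/-- Equal to 1 up to `Δ`, linear between `Δ` and `ρ`, and 0 afterwards. -/
def timerPhaseDeriv (Δ ρ s : ℝ) : ℝ := (max (ρ - s) 0 - max (Δ - s) 0) / (ρ - Δ)

variable {Δ ρ : ℝ}

theorem hasDerivAt_timerPhase (hΔ : Δ < ρ) (s : ℝ) :
    HasDerivAt (timerPhase Δ ρ) (timerPhaseDeriv Δ ρ s) s := by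
  have h (c : ℝ) : HasDerivAt (fun s : ℝ => max (c - s) 0 ^ 2) (2 * max (c - s) 0 * (-1)) s :=
    (hasDerivAt_max_zero_sq (c - s)).comp s ((hasDerivAt_id s).const_sub c)
  have h1 := (((h ρ).sub (h Δ)).div_const (2 * (ρ - Δ))).const_sub ((ρ + Δ) / 2)
  refine h1.congr_deriv ?_
  unfold timerPhaseDeriv
  have : ρ - Δ ≠ 0 := by linarith
  field_simp
  ring

theorem timerPhaseDeriv_nonneg (hΔ : Δ < ρ) (s : ℝ) : 0 ≤ timerPhaseDeriv Δ ρ s := by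
  refine div_nonneg (sub_nonneg.2 (max_le_max_right 0 (by linarith))) (by linarith)

theorem timerPhaseDeriv_of_le (hΔ : Δ < ρ) {s : ℝ} (hs : s ≤ Δ) : timerPhaseDeriv Δ ρ s = 1 := by
  unfold timerPhaseDeriv
  rw [max_eq_left (by linarith), max_eq_left (by linarith), div_eq_one_iff_eq (by linarith)]
  ring

theorem timerPhaseDeriv_of_ge (hΔ : Δ < ρ) {s : ℝ} (hs : ρ ≤ s) : timerPhaseDeriv Δ ρ s = 0 := by
  unfold timerPhaseDeriv
  rw [max_eq_right (by linarith), max_eq_right (by linarith), sub_self, zero_div]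

theorem timerPhase_mem_Icc (h0 : 0 < Δ) (hΔ : Δ < ρ) {s : ℝ} (hs : 0 ≤ s) :
    timerPhase Δ ρ s ∈ Icc 0 ρ := by
  have h1 : max (Δ - s) 0 ≤ max (ρ - s) 0 := max_le_max_right 0 (by linarith)
  have h2 : max (ρ - s) 0 ≤ max (Δ - s) 0 + (ρ - Δ) :=
    max_le (by linarith [le_max_left (Δ - s) 0]) (by linarith [le_max_right (Δ - s) 0])
  have h3 : max (ρ - s) 0 ≤ ρ := max_le (by linarith) (by linarith)
  have h4 : max (Δ - s) 0 ≤ Δ := max_le (by linarith) (by linarith)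
  have h5 : 0 ≤ max (Δ - s) 0 := le_max_right _ _
  set u := max (ρ - s) 0
  set v := max (Δ - s) 0
  have hpos : 0 < ρ - Δ := by linarith
  -- The difference of squares factors, with u - v ≤ ρ - Δ and u + v ≤ ρ + Δ.
  have e1 : (u ^ 2 - v ^ 2) / (2 * (ρ - Δ)) ≤ (ρ + Δ) / 2 := by
    rw [div_le_div_iff₀ (by positivity) (by norm_num)]
    have : (u - v) * (u + v) ≤ (ρ - Δ) * (ρ + Δ) :=
      mul_le_mul (by linarith) (by linarith) (by linarith) (by linarith)
    linarith
  have e2 : 0 ≤ (u ^ 2 - v ^ 2) / (2 * (ρ - Δ)) := by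
    apply div_nonneg _ (by positivity)
    have := pow_le_pow_left₀ h5 h1 2
    linarith
  unfold timerPhase
  constructor <;> linarith

end TimerPhase

/-! ### State coordinates, distance to the attractor, regularity of the flow map. -/

variable {n q : ℕ}

namespace State

def xL (n q : ℕ) : State n q →ₗ[ℝ] EuclideanSpace ℝ (Fin n) where
  toFun := State.x
  map_add' _ _ := rfl
  map_smul' _ _ := rfl

def eL (n q : ℕ) : State n q →ₗ[ℝ] EuclideanSpace ℝ (Fin q) where
  toFun := State.e
  map_add' _ _ := rfl
  map_smul' _ _ := rfl

def τL (n q : ℕ) : State n q →ₗ[ℝ] EuclideanSpace ℝ (Fin q) where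
  toFun := State.τ
  map_add' _ _ := rfl
  map_smul' _ _ := rfl

theorem continuous_x : Continuous (State.x : State n q → _) :=
  (xL n q).continuous_of_finiteDimensional

theorem continuous_e (i : Fin q) : Continuous fun X : State n q => State.e X i :=
  (EuclideanSpace.proj i).continuous.comp (eL n q).continuous_of_finiteDimensional

theorem continuous_τ (i : Fin q) : Continuous fun X : State n q => State.τ X i :=
  (EuclideanSpace.proj i).continuous.comp (τL n q).continuous_of_finiteDimensional

variable {X : ℝ → State n q} {v : State n q} {s : Set ℝ} {t : ℝ}

theorem hasDerivAt_x (h : HasDerivAt X v t) :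
    HasDerivAt (fun s => State.x (X s)) (State.x v) t :=
  (LinearMap.toContinuousLinearMap (xL n q)).hasFDerivAt.comp_hasDerivAt t h

theorem hasDerivWithinAt_τ (h : HasDerivWithinAt X v s t) (i : Fin q) :
    HasDerivWithinAt (fun s => State.τ (X s) i) (State.τ v i) s t :=
  ((EuclideanSpace.proj i).comp
    (LinearMap.toContinuousLinearMap (τL n q))).hasFDerivAt.comp_hasDerivWithinAt t h

theorem hasDerivAt_e (h : HasDerivAt X v t) (i : Fin q) :
    HasDerivAt (fun s => State.e (X s) i) (State.e v i) t :=
  ((EuclideanSpace.proj i).comp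
    (LinearMap.toContinuousLinearMap (eL n q))).hasFDerivAt.comp_hasDerivAt t h

theorem hasDerivAt_τ (h : HasDerivAt X v t) (i : Fin q) :
    HasDerivAt (fun s => State.τ (X s) i) (State.τ v i) t :=
  ((EuclideanSpace.proj i).comp
    (LinearMap.toContinuousLinearMap (τL n q))).hasFDerivAt.comp_hasDerivAt t h

theorem dist_sq (X Y : State n q) : dist X Y ^ 2 = dist (State.x X) (State.x Y) ^ 2 +
    (dist (State.e X) (State.e Y) ^ 2 + dist (State.τ X) (State.τ Y) ^ 2) := by
  simp only [EuclideanSpace.dist_sq_eq, Fintype.sum_sum_type]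
  rfl

end State

theorem isCompact_attractor (n q : ℕ) (ρ : ℝ) : IsCompact (attractor n q ρ) := by
  set f : (Fin n ⊕ Fin q ⊕ Fin q → ℝ) → State n q := WithLp.toLp 2
  have hf : Continuous f := PiLp.continuous_toLp 2 _
  have hK : IsCompact (Set.univ.pi fun k : Fin n ⊕ Fin q ⊕ Fin q =>
      Sum.elim (fun _ => Icc (0 : ℝ) 0) (Sum.elim (fun _ => Icc 0 0) (fun _ => Icc 0 (2 * ρ))) k) := by
    refine isCompact_univ_pi fun k => ?_
    rcases k with k | k | k <;> exact isCompact_Icc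
  convert hK.image hf using 1
  ext X
  constructor
  · rintro ⟨hx, he, hτ⟩
    refine ⟨X.ofLp, ?_, rfl⟩
    rintro (k | k | k) -
    · have : X (Sum.inl k) = 0 := congrArg (fun v : EuclideanSpace ℝ (Fin n) => v k) hx
      simpa using this
    · have : X (Sum.inr (Sum.inl k)) = 0 :=
        congrArg (fun v : EuclideanSpace ℝ (Fin q) => v k) he
      simpa using this
    · exact hτ k
  · rintro ⟨g, hg, rfl⟩
    refine ⟨?_, ?_, fun i => hg (Sum.inr (Sum.inr i)) trivial⟩
    · ext k
      have : g (Sum.inl k) ∈ Icc (0 : ℝ) 0 := hg (Sum.inl k) trivial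
      exact le_antisymm this.2 this.1
    · ext k
      have : g (Sum.inr (Sum.inl k)) ∈ Icc (0 : ℝ) 0 := hg (Sum.inr (Sum.inl k)) trivial
      exact le_antisymm this.2 this.1

theorem attractor_nonempty (n q : ℕ) {ρ : ℝ} (hρ : 0 ≤ ρ) : (attractor n q ρ).Nonempty :=
  ⟨0, rfl, rfl, fun _ => ⟨le_rfl, by positivity⟩⟩

/-- The squared distance to the attractor of a state with nonnegative timers. -/
def excess (ρ : ℝ) (X : State n q) : ℝ :=
  ‖State.x X‖ ^ 2 + (∑ i, State.e X i ^ 2 + ∑ i, max (State.τ X i - 2 * ρ) 0 ^ 2)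

/-- A nearest point sets x and e to zero and clips the timers at 2ρ; nonnegative timers need no
clipping from below. -/
theorem infDist_sq_eq_excess {ρ : ℝ} (hρ : 0 ≤ ρ) {X : State n q}
    (hX : ∀ i, 0 ≤ State.τ X i) : Metric.infDist X (attractor n q ρ) ^ 2 = excess ρ X := by
  have hne := attractor_nonempty n q hρ
  obtain ⟨Y, hY, hdist⟩ := (isCompact_attractor n q ρ).exists_infDist_eq_dist hne X
  apply le_antisymm
  · set Z : State n q := State.mk 0 0 (WithLp.toLp 2 fun i => min (State.τ X i) (2 * ρ))
    have hZ : Z ∈ attractor n q ρ :=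
      ⟨rfl, rfl, fun i => ⟨le_min (hX i) (by positivity), min_le_right _ _⟩⟩
    have h1 : Metric.infDist X (attractor n q ρ) ^ 2 ≤ dist X Z ^ 2 :=
      pow_le_pow_left₀ Metric.infDist_nonneg (Metric.infDist_le_dist_of_mem hZ) 2
    refine h1.trans (le_of_eq ?_)
    rw [State.dist_sq, show State.x Z = 0 from rfl, show State.e Z = 0 from rfl,
      dist_zero_right, dist_zero_right, EuclideanSpace.real_norm_sq_eq (State.e X),
      EuclideanSpace.dist_sq_eq (State.τ X)]
    unfold excess
    congr 2
    refine Finset.sum_congr rfl fun i _ => ?_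
    rw [show State.τ Z i = min (State.τ X i) (2 * ρ) from rfl, Real.dist_eq, sq_abs]
    rcases le_total (State.τ X i) (2 * ρ) with h | h
    · rw [min_eq_left h, max_eq_right (by linarith), sub_self]
    · rw [min_eq_right h, max_eq_left (by linarith)]
  · rw [hdist, State.dist_sq, hY.1, hY.2.1, dist_zero_right, dist_zero_right,
      EuclideanSpace.real_norm_sq_eq (State.e X), EuclideanSpace.dist_sq_eq (State.τ X)]
    unfold excess
    gcongr with i
    rw [Real.dist_eq]
    refine max_le ?_ (abs_nonneg _)
    linarith [(hY.2.2 i).2, le_abs_self (State.τ X i - State.τ Y i)]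

theorem exists_lipschitzWith_flowMap (S : Data n q) (ρ : ℝ) :
    ∃ K, LipschitzWith K (flowMap S ρ) := by
  have hlin : ∀ L : State n q →ₗ[ℝ] ℝ, ∃ K, LipschitzWith K L := fun L =>
    ⟨_, (LinearMap.toContinuousLinearMap L).lipschitz⟩
  have hcoord : ∀ k, ∃ K, LipschitzWith K fun X : State n q => flowMap S ρ X k := by
    rintro (k | k | k)
    · exact hlin ((LinearMap.proj k).comp ((S.F₁₁.mulVecLin.comp
        ((WithLp.linearEquiv 2 ℝ (Fin n → ℝ)).toLinearMap.comp (State.xL n q))) +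
        S.F₁₂.mulVecLin.comp
        ((WithLp.linearEquiv 2 ℝ (Fin q → ℝ)).toLinearMap.comp (State.eL n q))))
    · exact hlin ((LinearMap.proj k).comp ((S.F₂₁.mulVecLin.comp
        ((WithLp.linearEquiv 2 ℝ (Fin n → ℝ)).toLinearMap.comp (State.xL n q))) +
        S.F₂₂.mulVecLin.comp
        ((WithLp.linearEquiv 2 ℝ (Fin q → ℝ)).toLinearMap.comp (State.eL n q))))
    · obtain ⟨K1, h1⟩ := lipschitzWith_dz
      obtain ⟨K2, h2⟩ := hlin (ρ⁻¹ • (LinearMap.proj k).comp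
        ((WithLp.linearEquiv 2 ℝ (Fin q → ℝ)).toLinearMap.comp (State.τL n q)))
      have h3 := (LipschitzWith.const (1 : ℝ)).sub (h1.comp h2)
      refine ⟨0 + K1 * K2, ?_⟩
      have e : (fun X : State n q => flowMap S ρ X (Sum.inr (Sum.inr k))) =
          fun X => 1 - dz (ρ⁻¹ * State.τ X k) := by
        funext X
        change 1 - dz (State.τ X k / ρ) = 1 - dz (ρ⁻¹ * State.τ X k)
        rw [div_eq_inv_mul]
      rw [e]
      exact h3
  choose K hK using hcoord
  have hpi : LipschitzWith (∑ k, K k) fun X : State n q => (flowMap S ρ X).ofLp := by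
    refine LipschitzWith.of_dist_le_mul fun X Y => ?_
    rw [dist_pi_le_iff (by positivity)]
    intro k
    refine ((hK k).dist_le_mul X Y).trans ?_
    gcongr
    exact Finset.single_le_sum (f := K) (fun _ _ => zero_le) (Finset.mem_univ k)
  exact ⟨_, (PiLp.lipschitzWith_toLp 2 (fun _ : Fin n ⊕ Fin q ⊕ Fin q => ℝ)).comp hpi⟩

end TLazy

/-! ### Consequences of the triggering policy. -/

namespace TLazy

variable {n q : ℕ}

theorem norm_le_sum_abs (e : EuclideanSpace ℝ (Fin q)) : ‖e‖ ≤ ∑ i, |e i| := by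
  refine abs_le_of_sq_le_sq' ?_ (Finset.sum_nonneg fun i _ => abs_nonneg _) |>.2
  rw [EuclideanSpace.real_norm_sq_eq]
  calc ∑ i, e i ^ 2 = ∑ i, |e i| ^ 2 := by simp
    _ ≤ _ := Finset.sum_sq_le_sq_sum_of_nonneg fun i _ => abs_nonneg _

theorem hasDerivAt_quadForm {M : Matrix (Fin n) (Fin n) ℝ} (hM : Mᵀ = M)
    {x : ℝ → EuclideanSpace ℝ (Fin n)} {v : EuclideanSpace ℝ (Fin n)} {t : ℝ}
    (h : HasDerivAt x v t) : HasDerivAt (fun s => (x s).ofLp ⬝ᵥ M *ᵥ (x s).ofLp)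
      (2 * ((x t).ofLp ⬝ᵥ M *ᵥ v.ofLp)) t := by
  have hA := (Matrix.toEuclideanCLM (n := Fin n) (𝕜 := ℝ) M).hasFDerivAt.comp_hasDerivAt t h
  have h1 := h.inner ℝ hA
  have h2 : (fun s => (x s).ofLp ⬝ᵥ M *ᵥ (x s).ofLp) =
      fun s => inner ℝ (x s) ((⇑(Matrix.toEuclideanCLM (n := Fin n) (𝕜 := ℝ) M) ∘ x) s) := by
    funext s
    exact dotProduct_eq_inner _ (act M (x s))
  rw [h2]
  refine h1.congr_deriv ?_
  change inner ℝ (x t) (act M v) + inner ℝ v (act M (x t)) = _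
  rw [← dotProduct_eq_inner, ← dotProduct_eq_inner]
  change (x t).ofLp ⬝ᵥ M *ᵥ v.ofLp + v.ofLp ⬝ᵥ M *ᵥ (x t).ofLp = _
  have : v.ofLp ⬝ᵥ M *ᵥ (x t).ofLp = (x t).ofLp ⬝ᵥ M *ᵥ v.ofLp := by
    rw [Matrix.dotProduct_mulVec, ← Matrix.mulVec_transpose, hM, dotProduct_comm]
  rw [this]; ring

namespace Data

variable {S : Data n q}

/-- `xᵀ Q x`. -/
def quadQ (S : Data n q) (x : EuclideanSpace ℝ (Fin n)) : ℝ := x.ofLp ⬝ᵥ S.Q *ᵥ x.ofLp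

/-- `xᵀ P₁ x`. -/
def quadP (S : Data n q) (x : EuclideanSpace ℝ (Fin n)) : ℝ := x.ofLp ⬝ᵥ S.P₁ *ᵥ x.ofLp

theorem Admissible.P₁_symm (h : S.Admissible) : S.P₁ᵀ = S.P₁ := by
  simpa using h.P₁_pos.isHermitian.eq

theorem a_nonneg (S : Data n q) : 0 ≤ S.a := mul_nonneg zero_le_two (opNorm_nonneg _)
theorem b_nonneg (S : Data n q) : 0 ≤ S.b := mul_nonneg zero_le_two (opNorm_nonneg _)
theorem c_nonneg (S : Data n q) : 0 ≤ S.c := mul_nonneg zero_le_two (opNorm_nonneg _)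

theorem Admissible.quadQ_ge (h : S.Admissible) (x : EuclideanSpace ℝ (Fin n)) :
    S.γx / S.ε * ‖x‖ ^ 2 ≤ S.quadQ x := by
  have := h.Q_large.posSemidef.dotProduct_mulVec_nonneg x.ofLp
  rw [Matrix.sub_mulVec, Matrix.smul_mulVec, Matrix.one_mulVec, star_trivial, dotProduct_sub,
    dotProduct_smul, dotProduct_eq_inner x x, real_inner_self_eq_norm_sq, smul_eq_mul] at this
  exact sub_nonneg.1 this

/-- The reserve left to a sensor still in its dwell time: αᵢ > ε cancels the ε in Q > (γₓ/ε) I. -/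
theorem Admissible.weight_mul_quadQ_ge (h : S.Admissible) (hw : S.AdmissibleWeights) (i : Fin q)
    (x : EuclideanSpace ℝ (Fin n)) : S.γx * ‖x‖ ^ 2 ≤ S.α i * S.quadQ x := by
  have h1 := h.quadQ_ge x
  have h2 : 0 ≤ S.γx / S.ε * ‖x‖ ^ 2 := by have := h.γx_pos; have := h.ε_pos; positivity
  have h3 := h.ε_pos
  calc S.γx * ‖x‖ ^ 2 = S.ε * (S.γx / S.ε * ‖x‖ ^ 2) := by field_simp
    _ ≤ S.α i * S.quadQ x := by
      have h4 := (hw.gt_ε i).le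
      have h5 := h3.le.trans h4
      gcongr

theorem Admissible.plant_derivative_le (h : S.Admissible) (x : EuclideanSpace ℝ (Fin n))
    (e : EuclideanSpace ℝ (Fin q)) :
    2 * (x.ofLp ⬝ᵥ S.P₁ *ᵥ (act S.F₁₁ x + act S.F₁₂ e).ofLp) ≤
      -S.quadQ x + S.a * ‖x‖ * ‖e‖ := by
  have h1 := h.lyapunov.dotProduct_mulVec_nonneg x.ofLp
  rw [star_trivial, Matrix.sub_mulVec, Matrix.neg_mulVec, Matrix.add_mulVec, dotProduct_sub,
    dotProduct_neg, dotProduct_add] at h1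
  have h2 : x.ofLp ⬝ᵥ (S.F₁₁ᵀ * S.P₁) *ᵥ x.ofLp = x.ofLp ⬝ᵥ (S.P₁ * S.F₁₁) *ᵥ x.ofLp := by
    rw [Matrix.dotProduct_mulVec, ← Matrix.mulVec_transpose, Matrix.transpose_mul,
      Matrix.transpose_transpose, h.P₁_symm, dotProduct_comm]
  have h3 := (le_abs_self _).trans (abs_dotProduct_mulVec_le (S.P₁ * S.F₁₂) x e)
  have h4 : x.ofLp ⬝ᵥ S.P₁ *ᵥ (act S.F₁₁ x + act S.F₁₂ e).ofLp =
      x.ofLp ⬝ᵥ (S.P₁ * S.F₁₁) *ᵥ x.ofLp + x.ofLp ⬝ᵥ (S.P₁ * S.F₁₂) *ᵥ e.ofLp := by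
    rw [WithLp.ofLp_add, Matrix.mulVec_add, dotProduct_add, Matrix.mulVec_mulVec,
      Matrix.mulVec_mulVec]
  rw [h4]
  unfold quadQ a
  linarith

/-- `P₁` is invertible, so the product with it cannot annihilate a nonzero B. The gain divides by
this constant. -/
theorem Admissible.a_pos (h : S.Admissible) (hB : S.B ≠ 0) : 0 < S.a := by
  refine mul_pos two_pos (opNorm_pos fun h0 => hB ?_)
  have := h.P₁_pos.isUnit
  obtain ⟨U, hU⟩ := this
  have : (U⁻¹ : (Matrix (Fin n) (Fin n) ℝ)ˣ).val * (S.P₁ * S.F₁₂) = S.B := by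
    rw [← hU, ← Matrix.mul_assoc, Units.inv_mul, Matrix.one_mul]; rfl
  rw [← this, h0, Matrix.mul_zero]

theorem AdmissibleWeights.q_pos (hw : S.AdmissibleWeights) : 0 < q := by
  rcases Nat.eq_zero_or_pos q with rfl | hq
  · simpa using hw.sum_eq_one
  · exact hq

theorem AdmissibleWeights.B_ne_zero (hw : S.AdmissibleWeights)
    (hnondeg : S.C * S.B ≠ 0 ∨ S.B.rank = q) : S.B ≠ 0 := by
  intro h0
  rcases hnondeg with h | h
  · exact h (by rw [h0, Matrix.mul_zero])
  · rw [h0, Matrix.rank_zero] at h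
    exact hw.q_pos.ne h

theorem Admissible.weight_pos (h : S.Admissible) (hw : S.AdmissibleWeights) (i : Fin q) :
    0 < S.α i := h.ε_pos.trans (hw.gt_ε i)

theorem Admissible.weight_le_one (h : S.Admissible) (hw : S.AdmissibleWeights) (i : Fin q) :
    S.α i ≤ 1 := by
  rw [← hw.sum_eq_one]
  exact Finset.single_le_sum (f := S.α) (fun j _ => (h.weight_pos hw j).le) (Finset.mem_univ i)

/-- The cross term of the trigger is dominated inside `C̄ᵢ`. -/
theorem Admissible.cross_le_of_mem_Cbar (h : S.Admissible) {i : Fin q}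
    {x : EuclideanSpace ℝ (Fin n)} {s : ℝ} (hC : (x, s) ∈ S.Cbar i) :
    S.a * ‖x‖ * |s| ≤ S.α i * S.quadQ x - S.γx * ‖x‖ ^ 2 := by
  have h1 : S.trigger i x s ≤ -S.γx * ‖x‖ ^ 2 := hC
  unfold trigger at h1
  have hp := (h.p_pos i).le
  have hb := S.b_nonneg
  have hc := S.c_nonneg
  have h2 : 0 ≤ S.b * S.p i * ‖x‖ * |s| := by positivity
  have h3 : 0 ≤ S.c * S.p i * s ^ 2 := by positivity
  unfold quadQ
  linarith

/-- The gain of the bound `|eᵢ| ≤ κ |x|` valid in `C̄ᵢ`. -/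
def gain (S : Data n q) : ℝ := opNorm S.Q / S.a

theorem gain_nonneg (S : Data n q) : 0 ≤ S.gain := div_nonneg (opNorm_nonneg _) S.a_nonneg

/-- In C̄ᵢ, a|x||eᵢ| ≤ αᵢ xᵀQx ≤ |Q||x|²; cancelling one factor |x| is what requires x ≠ 0. -/
theorem Admissible.abs_le_gain_mul (h : S.Admissible) (hw : S.AdmissibleWeights) (ha : 0 < S.a)
    {i : Fin q} {x : EuclideanSpace ℝ (Fin n)} {s : ℝ} (hC : (x, s) ∈ S.Cbar i) (hx : x ≠ 0) :
    |s| ≤ S.gain * ‖x‖ := by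
  have h1 := h.cross_le_of_mem_Cbar hC
  have hx' : 0 < ‖x‖ := norm_pos_iff.2 hx
  have h2 : S.quadQ x ≤ opNorm S.Q * ‖x‖ * ‖x‖ :=
    (le_abs_self _).trans (abs_dotProduct_mulVec_le S.Q x x)
  have h0 : 0 ≤ S.quadQ x := by
    have := h.quadQ_ge x
    have h5 := h.γx_pos; have h6 := h.ε_pos
    exact le_trans (by positivity) this
  have h3 : S.α i * S.quadQ x ≤ 1 * S.quadQ x := by
    gcongr
    exact h.weight_le_one hw i
  have h4 : 0 ≤ S.γx * ‖x‖ ^ 2 := by have := h.γx_pos; positivity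
  unfold gain
  rw [div_mul_eq_mul_div, le_div_iff₀ ha]
  refine le_of_mul_le_mul_right ?_ hx'
  linarith

theorem Admissible.eq_zero_of_mem_Cbar_zero (h : S.Admissible) (hCB : S.C * S.B ≠ 0) {i : Fin q}
    {s : ℝ} (hC : ((0 : EuclideanSpace ℝ (Fin n)), s) ∈ S.Cbar i) : s = 0 := by
  have h1 : S.trigger i 0 s ≤ -S.γx * ‖(0 : EuclideanSpace ℝ (Fin n))‖ ^ 2 := hC
  have hc : 0 < S.c := mul_pos two_pos (opNorm_pos (neg_ne_zero.2 hCB))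
  have hp := h.p_pos i
  simp [trigger] at h1
  have h2 : 0 < S.c * S.p i := mul_pos hc hp
  by_contra hs
  have : 0 < s ^ 2 := by positivity
  nlinarith

/-- Along flows, a sensor whose timer exceeds `Δ` has its error bounded by the plant state. -/
theorem Admissible.abs_le_gain_mul_of_flow (h : S.Admissible) (hw : S.AdmissibleWeights)
    (hnondeg : S.C * S.B ≠ 0 ∨ S.B.rank = q) {Δ ρ : ℝ} {X : ℝ → State n q} {t : ℝ}
    (hX : HasDerivAt X (flowMap S ρ (X t)) t) (hfl : ∀ᶠ s in 𝓝 t, X s ∈ flowSet S Δ)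
    {i : Fin q} (hi : Δ < State.τ (X t) i) :
    |State.e (X t) i| ≤ S.gain * ‖State.x (X t)‖ := by
  have ha := h.a_pos (hw.B_ne_zero hnondeg)
  have hτ : ∀ᶠ s in 𝓝 t, Δ < State.τ (X s) i :=
    ((State.continuous_τ i).continuousAt.comp hX.continuousAt).eventually_const_lt hi
  have hC : ∀ᶠ s in 𝓝 t, (State.x (X s), State.e (X s) i) ∈ S.Cbar i := by
    filter_upwards [hfl, hτ] with s hs hs'
    exact ((hs i).2).resolve_right (not_le.2 hs')
  by_cases hx : State.x (X t) = 0
  · rcases hnondeg with hCB | hrank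
    · have := hC.self_of_nhds
      rw [hx] at this
      rw [h.eq_zero_of_mem_Cbar_zero hCB this, hx]
      simp
    · by_cases he : State.e (X t) = 0
      · rw [he, hx]; simp
      have hder := State.hasDerivAt_x hX
      -- At x = 0 the plant velocity is Be, nonzero by injectivity of B. Hence x ≠ 0 at nearby
      -- times, where the bound is known, and it passes to the limit.
      have hne : State.x (flowMap S ρ (X t)) ≠ 0 := by
        change act S.F₁₁ (State.x (X t)) + act S.F₁₂ (State.e (X t)) ≠ 0
        rw [hx]
        intro h0
        have h1 : S.B *ᵥ (State.e (X t)).ofLp = 0 := by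
          have := congrArg WithLp.ofLp h0
          simpa [F₁₂] using this
        exact mulVec_ne_zero_of_rank_eq hrank (by simpa using he) h1
      have hev := hder.eventually_ne (c := 0) hne
      have hle : ∀ᶠ s in 𝓝[≠] t, |State.e (X s) i| ≤ S.gain * ‖State.x (X s)‖ := by
        filter_upwards [hev, hC.filter_mono nhdsWithin_le_nhds] with s h1 h2
        exact h.abs_le_gain_mul hw ha h2 h1
      have c1 : Tendsto (fun s => |State.e (X s) i|) (𝓝[≠] t) (𝓝 |State.e (X t) i|) :=
        ((continuous_abs.comp (State.continuous_e i)).continuousAt.comp hX.continuousAt).tendsto.mono_left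
          nhdsWithin_le_nhds
      have c2 : Tendsto (fun s => S.gain * ‖State.x (X s)‖) (𝓝[≠] t)
          (𝓝 (S.gain * ‖State.x (X t)‖)) :=
        (((continuous_const.mul State.continuous_x.norm).continuousAt).comp
          hX.continuousAt).tendsto.mono_left nhdsWithin_le_nhds
      exact le_of_tendsto_of_tendsto c1 c2 hle
  · exact h.abs_le_gain_mul hw ha hC.self_of_nhds hx

end Data

end TLazy

namespace TLazy

variable {n q : ℕ}

/-! ### The Lyapunov function, its bounds, and its evolution along flows and jumps. -/

section Lyapunov

/-- The weight of an error in the Lyapunov function, decreasing in the timer up to `ρ`. -/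
def errorWeight (μ M Δ ρ s : ℝ) : ℝ := μ * Real.exp (-(M * timerPhase Δ ρ s))

/-- The last sum penalises only timers above 2ρ, which makes the function comparable with the
squared distance to the attractor. -/
def lyap (S : Data n q) (μ M Δ ρ : ℝ) (X : State n q) : ℝ :=
  S.quadP (State.x X) + ∑ i, errorWeight μ M Δ ρ (State.τ X i) * State.e X i ^ 2 +
    ∑ i, max (State.τ X i - 2 * ρ) 0 ^ 2

/-- The derivative of the Lyapunov function at `X` in the direction `v`. -/
def lyapDeriv (S : Data n q) (μ M Δ ρ : ℝ) (X v : State n q) : ℝ :=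
  2 * ((State.x X).ofLp ⬝ᵥ S.P₁ *ᵥ (State.x v).ofLp) +
    ∑ i, errorWeight μ M Δ ρ (State.τ X i) * (2 * State.e X i * State.e v i -
      M * timerPhaseDeriv Δ ρ (State.τ X i) * State.τ v i * State.e X i ^ 2) +
    ∑ i, 2 * max (State.τ X i - 2 * ρ) 0 * State.τ v i

variable {S : Data n q} {μ M Δ ρ : ℝ}

theorem hasDerivAt_lyap (h : S.Admissible) (hΔ : Δ < ρ) {X : ℝ → State n q} {v : State n q} {t : ℝ}
    (hX : HasDerivAt X v t) :
    HasDerivAt (fun s => lyap S μ M Δ ρ (X s)) (lyapDeriv S μ M Δ ρ (X t) v) t := by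
  unfold lyap lyapDeriv
  refine ((hasDerivAt_quadForm h.P₁_symm (State.hasDerivAt_x hX)).add
    (HasDerivAt.fun_sum fun i _ => ?_)).add (HasDerivAt.fun_sum fun i _ => ?_)
  · have h1 := ((hasDerivAt_timerPhase hΔ _).comp t (State.hasDerivAt_τ hX i)).const_mul M
    have h2 := (h1.neg.exp.const_mul μ).mul ((State.hasDerivAt_e hX i).pow 2)
    refine h2.congr_deriv ?_
    simp only [errorWeight, Function.comp_apply, Pi.neg_apply, Pi.pow_apply]
    push_cast
    ring
  · exact (hasDerivAt_max_zero_sq _).comp t ((State.hasDerivAt_τ hX i).sub_const (2 * ρ))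

theorem continuous_lyap (S : Data n q) (μ M Δ ρ : ℝ) : Continuous (lyap S μ M Δ ρ) := by
  unfold lyap Data.quadP errorWeight timerPhase
  have hx : Continuous fun X : State n q => (State.x X).ofLp :=
    (PiLp.continuous_ofLp 2 (fun _ : Fin n => ℝ)).comp State.continuous_x
  have he := State.continuous_e (n := n) (q := q)
  have hτ := State.continuous_τ (n := n) (q := q)
  refine ((hx.dotProduct (continuous_const.matrix_mulVec hx)).add
    (continuous_finsetSum _ fun i _ => ?_)).add (continuous_finsetSum _ fun i _ => ?_)
  · have := he i; have := hτ i; fun_prop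
  · have := hτ i; fun_prop

theorem errorWeight_le (hμ : 0 < μ) (hM : 0 < M) (h0 : 0 < Δ) (hΔ : Δ < ρ) {s : ℝ} (hs : 0 ≤ s) :
    errorWeight μ M Δ ρ s ≤ μ := by
  have h1 := (timerPhase_mem_Icc h0 hΔ hs).1
  have h2 : Real.exp (-(M * timerPhase Δ ρ s)) ≤ 1 := by
    rw [Real.exp_le_one_iff]
    have := mul_nonneg hM.le h1
    linarith
  unfold errorWeight
  exact mul_le_of_le_one_right hμ.le h2

theorem le_errorWeight (hμ : 0 < μ) (hM : 0 < M) (h0 : 0 < Δ) (hΔ : Δ < ρ) (hMρ : M * ρ ≤ 1)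
    {s : ℝ} (hs : 0 ≤ s) : μ / 3 ≤ errorWeight μ M Δ ρ s := by
  have h1 := (timerPhase_mem_Icc h0 hΔ hs).2
  have h2 : Real.exp (-1) ≤ Real.exp (-(M * timerPhase Δ ρ s)) := by
    rw [Real.exp_le_exp]
    have := mul_le_mul_of_nonneg_left h1 hM.le
    linarith
  -- The factor 1/3 comes from e < 3.
  have h3 : 1 / 3 ≤ Real.exp (-1) := by
    rw [Real.exp_neg, ← one_div]
    exact one_div_le_one_div_of_le (Real.exp_pos 1) (by linarith [Real.exp_one_lt_d9])
  unfold errorWeight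
  calc μ / 3 = μ * (1 / 3) := by ring
    _ ≤ _ := by gcongr; exact h3.trans h2

theorem errorWeight_nonneg (hμ : 0 < μ) (s : ℝ) : 0 ≤ errorWeight μ M Δ ρ s := by
  unfold errorWeight; positivity

theorem quadP_nonneg (h : S.Admissible) (x : EuclideanSpace ℝ (Fin n)) : 0 ≤ S.quadP x := by
  have := h.P₁_pos.posSemidef.dotProduct_mulVec_nonneg x.ofLp
  rwa [star_trivial] at this

theorem quadP_le (S : Data n q) (x : EuclideanSpace ℝ (Fin n)) :
    S.quadP x ≤ opNorm S.P₁ * ‖x‖ ^ 2 := by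
  have := (le_abs_self _).trans (abs_dotProduct_mulVec_le S.P₁ x x)
  unfold Data.quadP
  linarith

theorem exists_mul_excess_le_lyap (h : S.Admissible) (hμ : 0 < μ) (hM : 0 < M) :
    ∃ c > 0, ∀ Δ ρ, 0 < Δ → Δ < ρ → M * ρ ≤ 1 → ∀ X : State n q, (∀ i, 0 ≤ State.τ X i) →
      c * excess ρ X ≤ lyap S μ M Δ ρ X := by
  obtain ⟨cP, hcP, hP⟩ := exists_le_dotProduct_mulVec h.P₁_pos
  refine ⟨min (min cP (μ / 3)) 1, by positivity, fun Δ ρ h0 hΔ hMρ X hX => ?_⟩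
  unfold excess lyap
  rw [mul_add, mul_add, ← add_assoc]
  gcongr ?_ + ?_ + ?_
  · refine le_trans ?_ (hP (State.x X))
    gcongr
    exact (min_le_left _ _).trans (min_le_left _ _)
  · rw [Finset.mul_sum]
    gcongr with i
    exact ((min_le_left _ _).trans (min_le_right _ _)).trans
      (le_errorWeight hμ hM h0 hΔ hMρ (hX i))
  · refine mul_le_of_le_one_left (by positivity) (min_le_right _ _)

theorem lyap_le_mul_excess (S : Data n q) (hμ : 0 < μ) (hM : 0 < M) (h0 : 0 < Δ) (hΔ : Δ < ρ)
    {X : State n q} (hX : ∀ i, 0 ≤ State.τ X i) :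
    lyap S μ M Δ ρ X ≤ (opNorm S.P₁ + μ + 1) * excess ρ X := by
  have hP := opNorm_nonneg S.P₁
  unfold excess lyap
  rw [mul_add, mul_add, ← add_assoc]
  gcongr ?_ + ?_ + ?_
  · refine (quadP_le S _).trans ?_
    gcongr
    linarith
  · rw [Finset.mul_sum]
    gcongr with i
    exact (errorWeight_le hμ hM h0 hΔ (hX i)).trans (by linarith)
  · refine le_mul_of_one_le_left (by positivity) (by linarith)

/-- Up to `ρ` the timer runs at unit rate; beyond it the phase is flat. Hence timers running
backwards, above 2ρ, never make a weight grow. -/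
theorem timer_rate_mul (hΔ : Δ < ρ) (h0 : 0 < Δ) {s : ℝ} (hs : 0 ≤ s) :
    0 ≤ timerPhaseDeriv Δ ρ s * (1 - dz (s / ρ)) := by
  rcases le_total s ρ with h | h
  · rw [dz_div_of_le (by linarith) hs h, sub_zero, mul_one]
    exact timerPhaseDeriv_nonneg hΔ s
  · rw [timerPhaseDeriv_of_ge hΔ h, zero_mul]

/-- Above 2ρ the timer rate is 2 - s/ρ = -(s - 2ρ)/ρ, so the excess contracts linearly. -/
theorem timer_excess_derivative (hρ : 0 < ρ) (s : ℝ) :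
    2 * max (s - 2 * ρ) 0 * (1 - dz (s / ρ)) = -(2 / ρ) * max (s - 2 * ρ) 0 ^ 2 := by
  rcases le_total s (2 * ρ) with h | h
  · rw [max_eq_right (by linarith)]; simp
  · rw [max_eq_left (by linarith), dz_div_of_ge hρ (by linarith)]
    field_simp
    ring

/-- The Lyapunov function decreases exponentially along flows. -/
theorem exists_lyapDeriv_le (h : S.Admissible) (hw : S.AdmissibleWeights) :
    ∃ μ > 0, ∃ M > 0, ∃ r > 0, ∀ Δ ρ, 0 < Δ → Δ < ρ → M * ρ ≤ 1 → ∀ X : State n q,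
      (∀ i, 0 ≤ State.τ X i) →
      (∀ i, Δ < State.τ X i → (State.x X, State.e X i) ∈ S.Cbar i ∧
        |State.e X i| ≤ S.gain * ‖State.x X‖) →
      lyapDeriv S μ M Δ ρ X (flowMap S ρ X) ≤ -(min r (2 / ρ)) * lyap S μ M Δ ρ X := by
  have hq : (0 : ℝ) < q := Nat.cast_pos.2 hw.q_pos
  obtain ⟨μ, hμ, M, hM, r, hr, hdecay⟩ := exists_decay_constants (q := q) (β := q * S.γx)
    (a := S.a) (κ := S.gain) (f := opNorm S.F₂₁ + opNorm S.F₂₂) (l := opNorm S.P₁ + 1)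
    (mul_pos hq h.γx_pos) S.gain_nonneg
    (add_nonneg (opNorm_nonneg _) (opNorm_nonneg _)) (by linarith [opNorm_nonneg S.P₁])
  refine ⟨μ, hμ, M, hM, r, hr, fun Δ ρ h0 hΔ hMρ X hX hflow => ?_⟩
  have hρ : 0 < ρ := h0.trans hΔ
  classical
  set x := State.x X
  set e := State.e X
  set τ := State.τ X
  set D : Fin q → ℝ := fun i => State.e (flowMap S ρ X) i
  set m : Fin q → ℝ := fun i => errorWeight μ M Δ ρ (τ i)
  have hτv : ∀ i, State.τ (flowMap S ρ X) i = 1 - dz (τ i / ρ) := fun i => rfl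
  have hW : ‖e‖ ≤ ∑ j, |e j| := norm_le_sum_abs e
  have hD : ∀ i, |D i| ≤ (opNorm S.F₂₁ + opNorm S.F₂₂) * (‖x‖ + ∑ j, |e j|) := by
    intro i
    have h1 : |D i| ≤ ‖act S.F₂₁ x + act S.F₂₂ e‖ :=
      PiLp.norm_apply_le (act S.F₂₁ x + act S.F₂₂ e) i
    have h2 := norm_add_le (act S.F₂₁ x) (act S.F₂₂ e)
    have h3 := norm_act_le S.F₂₁ x
    have h4 := norm_act_le S.F₂₂ e
    have h5 := mul_le_mul_of_nonneg_left hW (opNorm_nonneg S.F₂₂)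
    have h6 := mul_nonneg (opNorm_nonneg S.F₂₁) ((norm_nonneg e).trans hW)
    have h7 := mul_nonneg (opNorm_nonneg S.F₂₂) (norm_nonneg x)
    linarith
  have hplant : 2 * (x.ofLp ⬝ᵥ S.P₁ *ᵥ (State.x (flowMap S ρ X)).ofLp) ≤
      -(q * S.γx) * ‖x‖ ^ 2 + S.a * ‖x‖ * ∑ i, (if τ i ≤ Δ then |e i| else 0) := by
    have h1 := h.plant_derivative_le x e
    have h2 : S.a * ‖x‖ * ‖e‖ ≤ S.a * ‖x‖ * ∑ j, |e j| := by
      have := S.a_nonneg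
      gcongr
    -- Each sensor is charged to its own share of xᵀQx; summing with weights of total one consumes
    -- exactly xᵀQx and leaves q copies of γₓ|x|².
    have h3 : ∀ i ∈ Finset.univ, S.a * ‖x‖ * |e i| ≤ S.α i * S.quadQ x - S.γx * ‖x‖ ^ 2 +
        S.a * ‖x‖ * (if τ i ≤ Δ then |e i| else 0) := by
      intro i _
      split_ifs with hi
      · linarith [h.weight_mul_quadQ_ge hw i x]
      · linarith [h.cross_le_of_mem_Cbar (hflow i (not_le.1 hi)).1]
    have h4 := Finset.sum_le_sum h3
    rw [← Finset.mul_sum, Finset.sum_add_distrib, Finset.sum_sub_distrib, ← Finset.sum_mul,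
      hw.sum_eq_one, Finset.sum_const, Finset.card_univ, Fintype.card_fin, nsmul_eq_mul,
      ← Finset.mul_sum] at h4
    have h5 : 2 * (x.ofLp ⬝ᵥ S.P₁ *ᵥ (State.x (flowMap S ρ X)).ofLp) ≤
      -S.quadQ x + S.a * ‖x‖ * ‖e‖ := h1
    linarith
  have hmain := hdecay ‖x‖ (S.quadP x) (2 * (x.ofLp ⬝ᵥ S.P₁ *ᵥ (State.x (flowMap S ρ X)).ofLp))
    (fun i => |e i|) D m (fun i => M * timerPhaseDeriv Δ ρ (τ i) * (1 - dz (τ i / ρ)))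
    (fun i => τ i ≤ Δ) (norm_nonneg _) (fun i => abs_nonneg _)
    (fun i => le_errorWeight hμ hM h0 hΔ hMρ (hX i)) (fun i => errorWeight_le hμ hM h0 hΔ (hX i))
    (fun i hi => (hflow i (not_le.1 hi)).2)
    (fun i => by
      rw [mul_assoc]
      exact mul_nonneg hM.le (timer_rate_mul hΔ h0 (hX i)))
    (fun i hi => by
      rw [timerPhaseDeriv_of_le hΔ hi, dz_div_of_le hρ (hX i) (hi.trans hΔ.le)]; ring)
    hD ((quadP_le S x).trans (by gcongr; linarith)) hplant
  simp only [sq_abs] at hmain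
  have herr : ∑ i, m i * (2 * e i * D i -
      M * timerPhaseDeriv Δ ρ (τ i) * (1 - dz (τ i / ρ)) * e i ^ 2) ≤
      ∑ i, m i * (2 * |e i| * |D i| -
      M * timerPhaseDeriv Δ ρ (τ i) * (1 - dz (τ i / ρ)) * e i ^ 2) := by
    refine Finset.sum_le_sum fun i _ => ?_
    refine mul_le_mul_of_nonneg_left ?_ (errorWeight_nonneg hμ _)
    have := le_abs_self (e i * D i)
    rw [abs_mul] at this
    linarith
  have htim : ∑ i, 2 * max (τ i - 2 * ρ) 0 * (1 - dz (τ i / ρ)) =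
      -(2 / ρ) * ∑ i, max (τ i - 2 * ρ) 0 ^ 2 := by
    rw [Finset.mul_sum]
    exact Finset.sum_congr rfl fun i _ => timer_excess_derivative hρ _
  have hV0 : 0 ≤ S.quadP x + ∑ i, m i * e i ^ 2 :=
    add_nonneg (quadP_nonneg h x) (Finset.sum_nonneg fun i _ =>
      mul_nonneg (errorWeight_nonneg hμ _) (sq_nonneg _))
  have hT0 : 0 ≤ ∑ i, max (τ i - 2 * ρ) 0 ^ 2 := by positivity
  have e1 := mul_le_mul_of_nonneg_right (min_le_left r (2 / ρ)) hV0
  have e2 := mul_le_mul_of_nonneg_right (min_le_right r (2 / ρ)) hT0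
  have goal_eq : lyapDeriv S μ M Δ ρ X (flowMap S ρ X) =
      2 * (x.ofLp ⬝ᵥ S.P₁ *ᵥ (State.x (flowMap S ρ X)).ofLp) +
      ∑ i, m i * (2 * e i * D i -
      M * timerPhaseDeriv Δ ρ (τ i) * (1 - dz (τ i / ρ)) * e i ^ 2) +
      ∑ i, 2 * max (τ i - 2 * ρ) 0 * (1 - dz (τ i / ρ)) := rfl
  have lyap_eq : lyap S μ M Δ ρ X = (S.quadP x + ∑ i, m i * e i ^ 2) +
      ∑ i, max (τ i - 2 * ρ) 0 ^ 2 := rfl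
  rw [goal_eq, lyap_eq, htim]
  linarith

open Classical in
theorem e_transmit (I : Set (Fin q)) (X : State n q) (i : Fin q) :
    State.e (transmit I X) i = if i ∈ I then 0 else State.e X i := by
  simp [State.e, transmit, State.mk]

open Classical in
theorem τ_transmit (I : Set (Fin q)) (X : State n q) (i : Fin q) :
    State.τ (transmit I X) i = if i ∈ I then 0 else State.τ X i := by
  simp [State.τ, transmit, State.mk]

/-- Resetting a timer restores the full weight μ, but the error it multiplies is reset to zero at
the same time. -/
theorem lyap_transmit_le (S : Data n q) (hμ : 0 < μ) (hρ : 0 < ρ) (I : Set (Fin q))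
    (X : State n q) : lyap S μ M Δ ρ (transmit I X) ≤ lyap S μ M Δ ρ X := by
  refine add_le_add (add_le_add le_rfl ?_) ?_
  · refine Finset.sum_le_sum fun i _ => ?_
    rw [e_transmit, τ_transmit]
    split_ifs
    · have := errorWeight_nonneg (M := M) (Δ := Δ) (ρ := ρ) hμ (State.τ X i)
      rw [zero_pow two_ne_zero, mul_zero]
      positivity
    · exact le_rfl
  · refine Finset.sum_le_sum fun i _ => ?_
    rw [τ_transmit]
    split_ifs
    · rw [max_eq_right (by linarith), zero_pow two_ne_zero]
      positivity
    · exact le_rfl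

end Lyapunov

end TLazy

/-! ### Solutions of the closed loop: timers, jump count, viability, exponential decay. -/

namespace TLazy

variable {n q : ℕ} {S : Data n q} {Δ ρ : ℝ} {R : JumpRule} {T : Set (ℝ × ℕ)}
  {φ : ℝ → ℕ → State n q}

open Hybrid

/-- A common description of both jump conventions; the jump estimates use nothing else about the
rule. -/
theorem exists_eq_transmit {X Y : State n q} (hX : X ∈ jumpSet S Δ) (hY : Y ∈ jumpMap S Δ R X) :
    ∃ I : Set (Fin q), I.Nonempty ∧ (∀ i ∈ I, Enabled S Δ X i) ∧ Y = transmit I X := by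
  cases R with
  | sequential =>
    obtain ⟨i, hi, rfl⟩ := hY
    exact ⟨{i}, singleton_nonempty i, by rintro j rfl; exact hi, rfl⟩
  | simultaneous => exact ⟨{i | Enabled S Δ X i}, hX.2, fun i hi => hi, hY⟩

theorem jumpMap_nonempty {X : State n q} (hX : X ∈ jumpSet S Δ) : (jumpMap S Δ R X).Nonempty := by
  cases R with
  | sequential =>
    obtain ⟨i, hi⟩ := hX.2
    exact ⟨_, i, hi, rfl⟩
  | simultaneous => exact ⟨_, rfl⟩

theorem continuous_flowMap (S : Data n q) (ρ : ℝ) : Continuous (flowMap S ρ) := by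
  obtain ⟨K, hK⟩ := exists_lipschitzWith_flowMap S ρ
  exact hK.continuous

theorem timers_nonneg (h : IsSolution (closedLoop S Δ ρ R) T φ) :
    ∀ t j, (t, j) ∈ T → ∀ i, 0 ≤ State.τ (φ t j) i := by
  refine h.arc.timeDomain.induction (P := fun t j => ∀ i, 0 ≤ State.τ (φ t j) i) ?_ ?_ ?_
  · intro i
    rcases h.start with h0 | h0
    · exact (h0 i).1
    · exact h0.1 i
  · intro j s hs t ht hst _ i
    obtain ⟨hc, -, hfl⟩ := h.flow_segment (continuous_flowMap S ρ) (fun _ => rfl) hs ht hst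
    -- The final time of a flow interval need not lie in the flow set, so the sign is obtained there
    -- by closure.
    have hmem : t ∈ closure (Ico s t) := by
      rw [closure_Ico hst.ne]; exact ⟨hst.le, le_rfl⟩
    have hc' : ContinuousOn (fun r => State.τ (φ r j) i) (closure (Ico s t)) := by
      rw [closure_Ico hst.ne]
      exact (State.continuous_τ i).comp_continuousOn hc
    exact le_on_closure (f := fun _ => (0 : ℝ)) (fun r hr => (hfl r hr i).1) continuousOn_const hc' hmem
  · intro t j h1 h2 hP i
    obtain ⟨hD, hG⟩ := h.jump t j h1 h2
    obtain ⟨I, -, -, hY⟩ := exists_eq_transmit hD hG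
    rw [hY, τ_transmit]
    split_ifs
    · exact le_rfl
    · exact hP i

/-- Every transmission is preceded by a dwell time of length `Δ`. -/
theorem jumps_mul_le (h : IsSolution (closedLoop S Δ ρ R) T φ) (h0 : 0 < Δ) (hρ : 0 < ρ) :
    ∀ t j, (t, j) ∈ T → (j : ℝ) * Δ ≤ q * Δ + q * t := by
  have hτ := timers_nonneg h
  -- The sum of the capped timers min(τᵢ, Δ) lies between 0 and qΔ, grows at rate at most q, and
  -- drops by at least Δ at each jump, since a transmitting timer falls from a value at least Δ to
  -- zero.
  have key : ∀ t j, (t, j) ∈ T →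
      (j : ℝ) * Δ + ∑ i, min (State.τ (φ t j) i) Δ ≤ q * Δ + q * t := by
    refine h.arc.timeDomain.induction
      (P := fun t j => (j : ℝ) * Δ + ∑ i, min (State.τ (φ t j) i) Δ ≤ q * Δ + q * t) ?_ ?_ ?_
    · have : ∑ i, min (State.τ (φ 0 0) i) Δ ≤ ∑ _i : Fin q, Δ :=
        Finset.sum_le_sum fun i _ => min_le_right _ _
      simpa using this
    · intro j s hs t ht hst hP
      obtain ⟨hc, hd, hfl⟩ := h.flow_segment (continuous_flowMap S ρ) (fun _ => rfl) hs ht hst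
      have hi : ∀ i, State.τ (φ t j) i - State.τ (φ s j) i ≤ 1 * (t - s) := by
        intro i
        have hder : ∀ r ∈ Ioo s t, HasDerivAt (fun r => State.τ (φ r j) i)
            (1 - dz (State.τ (φ r j) i / ρ)) r := fun r hr => State.hasDerivAt_τ (hd r hr) i
        refine (convex_Icc s t).image_sub_le_mul_sub_of_deriv_le (f := fun r => State.τ (φ r j) i)
          ((State.continuous_τ i).comp_continuousOn hc) ?_ ?_ s ⟨le_rfl, hst.le⟩ t
          ⟨hst.le, le_rfl⟩ hst.le
        · rw [interior_Icc]
          exact fun r hr => (hder r hr).differentiableAt.differentiableWithinAt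
        · rw [interior_Icc]
          intro r hr
          rw [(hder r hr).deriv]
          have h1 := (hfl r ⟨hr.1.le, hr.2⟩ i).1
          linarith [dz_nonneg (div_nonneg h1 hρ.le)]
      have hsum : ∑ i, min (State.τ (φ t j) i) Δ ≤
          ∑ i, (min (State.τ (φ s j) i) Δ + (t - s)) := by
        refine Finset.sum_le_sum fun i _ => ?_
        rw [← min_add_add_right]
        exact min_le_min (by linarith [hi i]) (by linarith)
      rw [Finset.sum_add_distrib, Finset.sum_const, Finset.card_univ, Fintype.card_fin,
        nsmul_eq_mul] at hsum
      linarith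
    · intro t j h1 h2 hP
      obtain ⟨hD, hG⟩ := h.jump t j h1 h2
      obtain ⟨I, ⟨k, hk⟩, hI, hY⟩ := exists_eq_transmit hD hG
      have hsum : ∑ i, min (State.τ (φ t (j + 1)) i) Δ + Δ ≤ ∑ i, min (State.τ (φ t j) i) Δ := by
        rw [← Finset.add_sum_erase _ _ (Finset.mem_univ k),
          ← Finset.add_sum_erase _ _ (Finset.mem_univ k), hY, τ_transmit, if_pos hk,
          min_eq_left h0.le, min_eq_right (hI k hk).2]
        have : ∑ i ∈ Finset.univ.erase k, min (State.τ (transmit I (φ t j)) i) Δ ≤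
            ∑ i ∈ Finset.univ.erase k, min (State.τ (φ t j) i) Δ := by
          refine Finset.sum_le_sum fun i _ => ?_
          rw [τ_transmit]
          split_ifs
          · exact min_le_min_right _ (hτ t j h1 i)
          · exact le_rfl
        linarith
      push_cast
      linarith
  intro t j htj
  have h1 := key t j htj
  have h2 : 0 ≤ ∑ i, min (State.τ (φ t j) i) Δ :=
    Finset.sum_nonneg fun i _ => le_min (hτ t j htj i) h0.le
  linarith

/-- States with no enabled sensor have room to flow. -/
theorem eventually_mem_flowSet (hρ : 0 < ρ) {X : State n q}
    (hX : ∀ i, 0 ≤ State.τ X i) (hD : X ∉ jumpSet S Δ) {t : ℝ} {y : ℝ → State n q} (hy : y t = X)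
    (hder : HasDerivWithinAt y (flowMap S ρ X) (Ici t) t) :
    ∀ᶠ s in 𝓝[≥] t, y s ∈ flowSet S Δ := by
  subst hy
  have hc := hder.continuousWithinAt
  have hcτ : ∀ i, ContinuousWithinAt (fun s => State.τ (y s) i) (Ici t) t := fun i =>
    (State.continuous_τ i).continuousAt.comp_continuousWithinAt hc
  refine eventually_all.2 fun i => Filter.Eventually.and ?_ ?_
  · rcases (hX i).lt_or_eq with hpos | hzero
    · filter_upwards [(hcτ i).eventually_const_lt hpos] with s hs using hs.le
    -- A timer at zero starts with unit rate, so it cannot become negative immediately.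
    · have h1 : HasDerivWithinAt (fun s => State.τ (y s) i) (1 - dz (State.τ (y t) i / ρ))
          (Ici t) t := State.hasDerivWithinAt_τ hder i
      rw [← hzero, dz_div_of_le hρ le_rfl hρ.le, sub_zero, hasDerivWithinAt_iff_tendsto_slope,
        Ici_sdiff_left] at h1
      have h2 := h1.eventually_const_lt one_pos
      rw [eventually_nhdsWithin_iff] at h2 ⊢
      filter_upwards [h2] with s hs hts
      rcases (mem_Ici.1 hts).eq_or_lt with rfl | hlt
      · exact hX i
      · have h3 := hs hlt
        rw [slope_def_field, ← hzero, sub_zero] at h3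
        exact ((div_pos_iff_of_pos_right (sub_pos.2 hlt)).1 h3).le
  · have hnot : ¬ Enabled S Δ (y t) i := fun hi => hD ⟨hX, i, hi⟩
    by_cases hτi : State.τ (y t) i < Δ
    · filter_upwards [(hcτ i).eventually_lt_const hτi] with s hs using Or.inr hs.le
    -- With τᵢ ≥ Δ, not being enabled means a strict trigger inequality, an open condition inside
    -- C̄ᵢ.
    · have hlt : S.trigger i (State.x (y t)) (State.e (y t) i) <
          -S.γx * ‖State.x (y t)‖ ^ 2 :=
        not_le.1 fun hle => hnot ⟨hle, not_lt.1 hτi⟩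
      have cx : Continuous fun X : State n q => (State.x X).ofLp :=
        (PiLp.continuous_ofLp 2 (fun _ : Fin n => ℝ)).comp State.continuous_x
      have ce := State.continuous_e (n := n) i
      have cxn := (State.continuous_x (n := n) (q := q)).norm
      have c1 : Continuous fun X : State n q => S.trigger i (State.x X) (State.e X i) := by
        unfold Data.trigger
        exact ((continuous_const.mul (cx.dotProduct (continuous_const.matrix_mulVec cx))).add
          ((continuous_const.mul cxn).mul ce.abs)).add (continuous_const.mul (ce.pow 2))
      have c2 : Continuous fun X : State n q => -S.γx * ‖State.x X‖ ^ 2 :=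
        continuous_const.mul (cxn.pow 2)
      have hev : ∀ᶠ X in 𝓝 (y t), S.trigger i (State.x X) (State.e X i) <
          -S.γx * ‖State.x X‖ ^ 2 := c1.continuousAt.eventually_lt c2.continuousAt hlt
      filter_upwards [hc.eventually hev] with s hs using Or.inl (le_of_lt hs)

theorem exists_isExponentiallyStable (h : S.Admissible) (hw : S.AdmissibleWeights)
    (hnondeg : S.C * S.B ≠ 0 ∨ S.B.rank = q) :
    ∃ ρ₀ > 0, ∀ Δ ρ : ℝ, 0 < Δ → Δ < ρ → ρ < ρ₀ → ∀ R : JumpRule,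
      IsExponentiallyStable (closedLoop S Δ ρ R) (attractor n q ρ) := by
  obtain ⟨μ, hμ, M, hM, r, hr, hdecay⟩ := exists_lyapDeriv_le h hw
  obtain ⟨c, hc, hlower⟩ := exists_mul_excess_le_lyap h hμ hM
  refine ⟨1 / M, by positivity, fun Δ ρ h0 hΔ hρM R => ?_⟩
  have hρ : 0 < ρ := h0.trans hΔ
  have hMρ : M * ρ ≤ 1 := by
    rw [lt_div_iff₀ hM] at hρM
    linarith
  have hq : (0 : ℝ) < q := Nat.cast_pos.2 hw.q_pos
  set l : ℝ := min r (2 / ρ)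
  have hl : 0 < l := lt_min hr (by positivity)
  set d : ℝ := opNorm S.P₁ + μ + 1
  have hd : 0 < d := by have := opNorm_nonneg S.P₁; positivity
  -- The decay `l` of the squared distance in t must pay for 2g(t + j). As j ≤ q + qt/Δ, half of it
  -- covers time and half covers jumps; the offset q becomes the factor exp(gq).
  set g : ℝ := min (l / 4) (l * Δ / (4 * q))
  have hg : 0 < g := lt_min (by positivity) (by positivity)
  have hg1 : g ≤ l / 4 := min_le_left _ _
  have hg2 : g * q ≤ l / 4 * Δ := by
    have : g ≤ l * Δ / (4 * q) := min_le_right _ _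
    rw [le_div_iff₀ (by positivity)] at this
    linarith
  refine ⟨g, hg, √(d / c) * Real.exp (g * q), by positivity, fun T φ hφ t j htj => ?_⟩
  have hτ := timers_nonneg hφ
  have hV : ∀ t j, (t, j) ∈ T →
      lyap S μ M Δ ρ (φ t j) ≤ Real.exp (-l * t) * lyap S μ M Δ ρ (φ 0 0) := by
    refine hφ.arc.timeDomain.induction (P := fun t j =>
      lyap S μ M Δ ρ (φ t j) ≤ Real.exp (-l * t) * lyap S μ M Δ ρ (φ 0 0)) (by simp) ?_ ?_
    · intro j s hs t ht hst hP
      obtain ⟨hcont, hder, hfl⟩ :=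
        hφ.flow_segment (continuous_flowMap S ρ) (fun _ => rfl) hs ht hst
      have h1 := le_exp_mul_of_deriv_le (r := l) hst.le
        ((continuous_lyap S μ M Δ ρ).comp_continuousOn hcont)
        (fun u hu => hasDerivAt_lyap h hΔ (hder u hu)) (fun u hu => by
          -- Membership on a whole neighbourhood of `u`, not only at `u`, is what the limiting
          -- argument at x = 0 requires.
          have hev : ∀ᶠ s in 𝓝 u, φ s j ∈ flowSet S Δ := by
            filter_upwards [Ioo_mem_nhds hu.1 hu.2] with r hr using hfl r ⟨hr.1.le, hr.2⟩
          have hu' := hfl u ⟨hu.1.le, hu.2⟩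
          exact hdecay Δ ρ h0 hΔ hMρ (φ u j) (fun i => (hu' i).1) fun i hi =>
            ⟨((hu' i).2).resolve_right (not_le.2 hi),
              h.abs_le_gain_mul_of_flow hw hnondeg (hder u hu) hev hi⟩)
      calc lyap S μ M Δ ρ (φ t j) ≤ Real.exp (-l * (t - s)) * lyap S μ M Δ ρ (φ s j) := h1
        _ ≤ Real.exp (-l * (t - s)) * (Real.exp (-l * s) * lyap S μ M Δ ρ (φ 0 0)) := by gcongr
        _ = _ := by rw [← mul_assoc, ← Real.exp_add]; ring_nf
    · intro t j h1 h2 hP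
      obtain ⟨hD, hG⟩ := hφ.jump t j h1 h2
      obtain ⟨I, -, -, hY⟩ := exists_eq_transmit hD hG
      rw [hY]
      exact (lyap_transmit_le S hμ hρ I _).trans hP
  have ht : 0 ≤ t := hφ.arc.timeDomain.nonneg htj
  have hj := jumps_mul_le hφ h0 hρ t j htj
  have hjg : g * j ≤ g * q + l / 4 * t := by
    have h1 : g * (j * Δ) ≤ g * (q * Δ + q * t) := by gcongr
    have h2 : g * q * t ≤ l / 4 * Δ * t := by gcongr
    refine le_of_mul_le_mul_right ?_ h0
    linarith
  have hgt : g * t ≤ l / 4 * t := by gcongr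
  have hexp : Real.exp (-l * t) ≤ (Real.exp (g * q) * Real.exp (-g * (t + j))) ^ 2 := by
    rw [← Real.exp_add, ← Real.exp_nat_mul, Real.exp_le_exp]
    push_cast
    linarith
  set D := Metric.infDist (φ t j) (attractor n q ρ)
  set D0 := Metric.infDist (φ 0 0) (attractor n q ρ)
  have hD0 : 0 ≤ D0 := Metric.infDist_nonneg
  have e1 : D ^ 2 = excess ρ (φ t j) := infDist_sq_eq_excess hρ.le (hτ t j htj)
  have h00 := hτ 0 0 hφ.arc.timeDomain.zero_mem
  have e2 : D0 ^ 2 = excess ρ (φ 0 0) := infDist_sq_eq_excess hρ.le h00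
  have b1 := hlower Δ ρ h0 hΔ hMρ (φ t j) (hτ t j htj)
  have b2 := lyap_le_mul_excess S hμ hM h0 hΔ h00
  rw [← e1] at b1
  rw [← e2] at b2
  refine abs_le_of_sq_le_sq' ?_ (by positivity) |>.2
  calc D ^ 2 = c * D ^ 2 / c := by field_simp
    _ ≤ Real.exp (-l * t) * (d * D0 ^ 2) / c :=
      div_le_div_of_nonneg_right (b1.trans ((hV t j htj).trans (by gcongr))) hc.le
    _ = d / c * Real.exp (-l * t) * D0 ^ 2 := by ring
    _ ≤ d / c * (Real.exp (g * q) * Real.exp (-g * (t + j))) ^ 2 * D0 ^ 2 := by gcongr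
    _ = (√(d / c) * Real.exp (g * q) * Real.exp (-g * (t + j)) * D0) ^ 2 := by
      rw [mul_pow, mul_pow, mul_pow, mul_pow, Real.sq_sqrt (by positivity)]
      ring

end TLazy

end

theorem theorem2 {n q : ℕ} (S : TLazy.Data n q)
    (hnominal : TLazy.LinearExpStable (S.A + S.B * S.C))
    (hpolicy : S.Admissible) (hweights : S.AdmissibleWeights)
    (hnondeg : S.C * S.B ≠ 0 ∨ S.B.rank = q) :
    ∃ ρ₀ > 0, ∀ Δ ρ : ℝ, 0 < Δ → Δ < ρ → ρ < ρ₀ → ∀ R : TLazy.JumpRule,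
      IsCompact (TLazy.attractor n q ρ) ∧
      Hybrid.IsGAS (TLazy.closedLoop S Δ ρ R) (TLazy.attractor n q ρ) ∧
      (S.B.rank = q →
        Hybrid.IsGES (TLazy.closedLoop S Δ ρ R) (TLazy.attractor n q ρ)) := by
  obtain ⟨ρ₀, hρ₀, hES⟩ := TLazy.exists_isExponentiallyStable hpolicy hweights hnondeg
  refine ⟨ρ₀, hρ₀, fun Δ ρ h0 hΔ hρρ R => ?_⟩
  have hρ : 0 < ρ := h0.trans hΔ
  have hstab := hES Δ ρ h0 hΔ hρρ R
  have hcpt := TLazy.isCompact_attractor n q ρ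
  have hne := TLazy.attractor_nonempty n q hρ.le
  have hbasin := hstab.basin_eq_univ hcpt hne
  refine ⟨hcpt, hstab.isGAS hcpt hne fun T φ hφ hmax => ?_, fun _ => ⟨hstab, hbasin⟩⟩
  obtain ⟨K, hK⟩ := TLazy.exists_lipschitzWith_flowMap S ρ
  have hmem : φ 0 0 ∈ Hybrid.basin (TLazy.closedLoop S Δ ρ R) (TLazy.attractor n q ρ) :=
    hbasin ▸ mem_univ _
  exact hφ.isComplete_of_isMaximal hK (fun _ => rfl) (V := {X | ∀ i, 0 ≤ TLazy.State.τ X i})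
    (TLazy.timers_nonneg hφ) (hmem T φ hφ rfl).1 (fun X hX => TLazy.jumpMap_nonempty hX)
    (fun X hX hD t y hy hder => TLazy.eventually_mem_flowSet hρ hX hD hy hder) hmax
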